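/- Let $r,s,n$ be positive integers. Work over $\mathbb{C}(q)$ with $\xi=q-q^{-1}$. Put $I_{N|N}=\{-N,\dots,-1,1,\dots,N\}$, $|i|=0$ for $i>0$ and $|i|=1$ for $i<0$; the matrix unit $E_{ij}$ has parity $|i|+|j|$, and all tensor products of superalgebras carry the usual sign rule. Let $\varphi(i,j)=(-1)^{|j|}(\delta_{i,j}+\delta_{i,-j})$ and $$S=\sum_{i,j\in I_{N|N}}q^{\varphi(i,j)}E_{ii}\otimes E_{jj}+\xi\sum_{i<j}(-1)^{|i|}(E_{ji}+E_{-j,-i})\otimes E_{ij},$$ with inverse $$S^{-1}=\sum_{i,j\in I_{N|N}}q^{-\varphi(i,j)}E_{ii}\otimes E_{jj}-\xi\sum_{i<j}(-1)^{|i|}(E_{ji}+E_{-j,-i})\otimes E_{ij}.$$ Let $\mathsf{A}_{r,n}$ be the unital associative superalgebra with generators $t_{ia}$ of parity $|i|+|a|$ ($i\in I_{r|r}$, $a\in I_{n|n}$) and relations $$t_{ia}=t_{-i,-a},\qquad S^{12}T^{1[3]}T^{2[3]}=T^{2[3]}T^{1[3]}S^{12},\qquad T=\sum_{i,a}E_{ia}\otimes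 t_{ia}.$$ Let $\bar{\mathsf{A}}_{s,n}$ be the unital associative superalgebra with generators $\bar t_{\alpha b}$ of parity $|\alpha|+|b|$ ($\alpha\in I_{s|s}$, $b\in I_{n|n}$) and relations $$\bar t_{\alpha b}=(-1)^{|\alpha|+|b|}\bar t_{-\alpha,-b},\qquad \bar T^{1[3]}\bar T^{2[3]}S^{12}=S^{12}\bar T^{2[3]}\bar T^{1[3]},\qquad \bar T=\sum_{\alpha,b}(-1)^{|b|(|\alpha|+|b|)}E_{b\alpha}\otimes\bar t_{\alpha b}.$$ Here upper indices name the tensor factors in which a matrix is placed, a bracketed index being that of its algebra coefficients, and in each relation $S$ and the identity matrices have the sizes that make the products of rectangular matrices meaningful. Put $T_+=\sum_{i=1}^{r}\sum_{a\in I_{n|n}}E_{ia}\otimes t_{ia}$. Then there is an even $\mathbb{C}(q)$-linear map $\Upsilon:\bar{\mathsf{A}}_{s,n}\otimes\mathsf{A}_{r,n}\to\mathsf{A}_{r,n}\otimes\bar{\mathsf{A}}_{s,n}$ such that 1. $\Upsilon\circ(1\otimes\mathrm{mul})=(\mathrm{mul}\otimes1)\circ(1\otimes\Upsilon)\circ(\Upsilon\otimes1)$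 on $\bar{\mathsf{A}}_{s,n}\otimes\mathsf{A}_{r,n}\otimes\mathsf{A}_{r,n}$, and $\Upsilon\circ(\mathrm{mul}\otimes1)=(1\otimes\mathrm{mul})\circ(\Upsilon\otimes1)\circ(1\otimes\Upsilon)$ on $\bar{\mathsf{A}}_{s,n}\otimes\bar{\mathsf{A}}_{s,n}\otimes\mathsf{A}_{r,n}$; 2. $\Upsilon(1\otimes f)=f\otimes1$ and $\Upsilon(\bar g\otimes1)=1\otimes\bar g$ for all $f\in\mathsf{A}_{r,n}$, $\bar g\in\bar{\mathsf{A}}_{s,n}$; 3. $\Upsilon\big(\bar T^{1[3]}T_+^{2[4]}\big)=T_+^{2[3]}(S^{-1})^{12}\,\bar T^{1[4]}$, where $\Upsilon$ is applied to the coefficients; 4. the composition $(\mathrm{mul}\otimes\mathrm{mul})\circ(\mathrm{id}\otimes\Upsilon\otimes\mathrm{id})$ is an associative multiplication on $\mathcal{O}_{r,s}=\mathsf{A}_{r,n}\otimes\bar{\mathsf{A}}_{s,n}$ with unit $1\otimes1$. -/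

import Mathlib

open scoped TensorProduct

noncomputable section

namespace QueerSuper

/-! ### Base field, indices and parities -/

/-- The base field `ℂ(q)`. -/
abbrev K : Type := RatFunc ℂ

/-- The indeterminate `q`. -/
def q : K := RatFunc.X

/-- `ξ = q - q⁻¹`. -/
def ξ : K := q - q⁻¹

/-- `I_{N|N} = {-N, …, -1, 1, …, N}`. -/
abbrev I (N : ℕ) : Type := {i : ℤ // i ∈ (Finset.Icc (-(N : ℤ)) N).erase 0}

/-- The positive indices `{1, …, N}` inside `I_{N|N}`. -/
abbrev IPos (N : ℕ) : Type := {i : I N // 0 < i.1}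

/-- The index `-i`. -/
def opp {N : ℕ} (i : I N) : I N :=
  ⟨-i.1, by
    have h := i.2
    simp only [Finset.mem_erase, Finset.mem_Icc] at h ⊢
    omega⟩

/-- Index types of homogeneous bases; `par i` is `0` for an even and `1` for an odd index. -/
class HasParity (ι : Type) where
  par : ι → ℕ

/-- The parity `|i|` of an index. -/
def par {ι : Type} [HasParity ι] (i : ι) : ℕ := HasParity.par i

instance instParityI (N : ℕ) : HasParity (I N) := ⟨fun i => if 0 < i.1 then 0 else 1⟩

instance instParityIPos (N : ℕ) : HasParity (IPos N) := ⟨fun i => par i.1⟩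

/-! ### Supermatrices

An element `∑ E_{ia} ⊗ x_{ia}` of `Hom ⊗ B` is stored as the matrix `(x_{ia})`, and an element
`∑ E_{ik} ⊗ E_{jl} ⊗ x` of `Hom ⊗ Hom ⊗ B` as the matrix whose entry at row `(i, j)` and column
`(k, l)` is the coefficient `x` of `E_{ik} ⊗ E_{jl}`. -/

section Supermatrix

variable {I₁ I₂ J₁ J₂ L₁ L₂ : Type}

/-- `X^{1[3]} = ∑ E_{ia} ⊗ 1 ⊗ x_{ia}`, the second tensor factor having a basis indexed by `L₁`. -/
def leg1 {B : Type} [Zero B] [DecidableEq L₁] (X : Matrix I₁ J₁ B) :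
    Matrix (I₁ × L₁) (J₁ × L₁) B :=
  fun u v => if u.2 = v.2 then X u.1 v.1 else 0

/-- `X^{2[3]} = ∑ 1 ⊗ E_{ia} ⊗ x_{ia}`, the first tensor factor having a basis indexed by `L₁`. -/
def leg2 {B : Type} [Zero B] [DecidableEq L₁] (X : Matrix I₁ J₁ B) :
    Matrix (L₁ × I₁) (L₁ × J₁) B :=
  fun u v => if u.1 = v.1 then X u.2 v.2 else 0

variable [HasParity I₁] [HasParity I₂] [HasParity J₁] [HasParity J₂] [HasParity L₁]
  [HasParity L₂] [Fintype J₁] [Fintype J₂]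

/-- Product of two even supermatrices, the coefficients being multiplied by the bilinear map `β`.
By the sign rule for graded tensor products,
`(E_{ik} ⊗ E_{jl} ⊗ x) (E_{km} ⊗ E_{lp} ⊗ y) = ± E_{im} ⊗ E_{jp} ⊗ β x y` with exponent
`|E_{jl}| |E_{km}| + |x| (|E_{km}| + |E_{lp}|)`. All supermatrices to which this is applied are
even, that is `|x| = |E_{ik}| + |E_{jl}|`, and this is how `|x|` enters. -/
def superMul {B C D : Type} [AddCommMonoid B] [Module K B] [AddCommMonoid C] [Module K C]
    [AddCommMonoid D] [Module K D] (β : B →ₗ[K] C →ₗ[K] D)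
    (X : Matrix (I₁ × I₂) (J₁ × J₂) B) (Y : Matrix (J₁ × J₂) (L₁ × L₂) C) :
    Matrix (I₁ × I₂) (L₁ × L₂) D :=
  fun u w => ∑ v : J₁ × J₂,
    (-1 : K) ^ ((par u.2 + par v.2) * (par v.1 + par w.1) +
      (par u.1 + par v.1 + par u.2 + par v.2) * (par v.1 + par w.1 + par v.2 + par w.2)) •
        β (X u v) (Y v w)

/-- Product of even supermatrices with coefficients in the same algebra. -/
def mulM {B : Type} [Semiring B] [Algebra K B]
    (X : Matrix (I₁ × I₂) (J₁ × J₂) B) (Y : Matrix (J₁ × J₂) (L₁ × L₂) B) :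
    Matrix (I₁ × I₂) (L₁ × L₂) B :=
  superMul (LinearMap.mul K B) X Y

/-- Product of a scalar even supermatrix with an even supermatrix. -/
def lscal {B : Type} [AddCommMonoid B] [Module K B]
    (X : Matrix (I₁ × I₂) (J₁ × J₂) K) (Y : Matrix (J₁ × J₂) (L₁ × L₂) B) :
    Matrix (I₁ × I₂) (L₁ × L₂) B :=
  superMul (LinearMap.lsmul K B) X Y

/-- Product of an even supermatrix with a scalar even supermatrix. -/
def rscal {B : Type} [AddCommMonoid B] [Module K B]
    (X : Matrix (I₁ × I₂) (J₁ × J₂) B) (Y : Matrix (J₁ × J₂) (L₁ × L₂) K) :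
    Matrix (I₁ × I₂) (L₁ × L₂) B :=
  superMul (LinearMap.lsmul K B).flip X Y

/-- Product of an even supermatrix over `B` with one over `C`, with coefficients `x ⊗ y`. -/
def tmulM {B C : Type} [AddCommMonoid B] [Module K B] [AddCommMonoid C] [Module K C]
    (X : Matrix (I₁ × I₂) (J₁ × J₂) B) (Y : Matrix (J₁ × J₂) (L₁ × L₂) C) :
    Matrix (I₁ × I₂) (L₁ × L₂) (B ⊗[K] C) :=
  superMul (TensorProduct.mk K B C) X Y

end Supermatrix

/-! ### The matrix `S` -/

/-- `φ(i, j) = (-1)^{|j|} (δ_{i,j} + δ_{i,-j})`. -/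
def φ {N : ℕ} (i j : I N) : ℤ :=
  (-1) ^ par j * ((if i = j then 1 else 0) + (if i = opp j then 1 else 0))

/-- The element `E_{ik} ⊗ E_{jl}`. -/
def E {N : ℕ} (i k j l : I N) : Matrix (I N × I N) (I N × I N) K :=
  Matrix.single (i, j) (k, l) 1

/-- `S = ∑ q^{φ(i,j)} E_{ii} ⊗ E_{jj} + ξ ∑_{i<j} (-1)^{|i|} (E_{ji} + E_{-j,-i}) ⊗ E_{ij}`. -/
def S (N : ℕ) : Matrix (I N × I N) (I N × I N) K :=
  (∑ i : I N, ∑ j : I N, q ^ φ i j • E i i j j) +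
    ξ • ∑ i : I N, ∑ j : I N,
      if i < j then (-1 : K) ^ par i • (E j i i j + E (opp j) (opp i) i j) else 0

/-- The inverse of `S`, given by
`∑ q^{-φ(i,j)} E_{ii} ⊗ E_{jj} - ξ ∑_{i<j} (-1)^{|i|} (E_{ji} + E_{-j,-i}) ⊗ E_{ij}`. -/
def Sinv (N : ℕ) : Matrix (I N × I N) (I N × I N) K :=
  (∑ i : I N, ∑ j : I N, q ^ (-φ i j) • E i i j j) -
    ξ • ∑ i : I N, ∑ j : I N,
      if i < j then (-1 : K) ^ par i • (E j i i j + E (opp j) (opp i) i j) else 0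

/-! ### The quantum coordinate superalgebra `A_{r,n}` -/

/-- The matrix `T = ∑ E_{ia} ⊗ t_{ia}` over the free superalgebra. -/
def freeT (r n : ℕ) : Matrix (I r) (I n) (FreeAlgebra K (I r × I n)) :=
  fun i a => FreeAlgebra.ι K (i, a)

/-- The defining relations `t_{ia} = t_{-i,-a}` and
`S^{12} T^{1[3]} T^{2[3]} = T^{2[3]} T^{1[3]} S^{12}` of `A_{r,n}`. -/
inductive ARel (r n : ℕ) : FreeAlgebra K (I r × I n) → FreeAlgebra K (I r × I n) → Prop
  | opp (i : I r) (a : I n) : ARel r n (freeT r n i a) (freeT r n (opp i) (opp a))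
  | rtt (u : I r × I r) (v : I n × I n) : ARel r n
      (mulM (lscal (S r) (leg1 (L₁ := I r) (freeT r n))) (leg2 (L₁ := I n) (freeT r n)) u v)
      (rscal (mulM (leg2 (L₁ := I r) (freeT r n)) (leg1 (L₁ := I n) (freeT r n))) (S n) u v)

/-- The quantum coordinate superalgebra `A_{r,n}`. -/
abbrev A (r n : ℕ) : Type := RingQuot (ARel r n)

/-- The generators `t_{ia}`, arranged as the matrix `T`. -/
def T (r n : ℕ) : Matrix (I r) (I n) (A r n) :=
  fun i a => RingQuot.mkAlgHom K (ARel r n) (FreeAlgebra.ι K (i, a))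

/-- `T_+ = ∑_{i=1}^{r} ∑_a E_{ia} ⊗ t_{ia}`. -/
def Tplus (r n : ℕ) : Matrix (IPos r) (I n) (A r n) :=
  fun i a => T r n i.1 a

/-! ### The dual quantum coordinate superalgebra `Ā_{s,n}` -/

/-- The matrix `T̄ = ∑ (-1)^{|b|(|α|+|b|)} E_{bα} ⊗ t̄_{αb}` over the free superalgebra. -/
def freeTbar (s n : ℕ) : Matrix (I n) (I s) (FreeAlgebra K (I s × I n)) :=
  fun b α => (-1 : K) ^ (par b * (par α + par b)) • FreeAlgebra.ι K (α, b)

/-- The defining relations `t̄_{αb} = (-1)^{|α|+|b|} t̄_{-α,-b}` and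
`T̄^{1[3]} T̄^{2[3]} S^{12} = S^{12} T̄^{2[3]} T̄^{1[3]}` of `Ā_{s,n}`. -/
inductive AbarRel (s n : ℕ) : FreeAlgebra K (I s × I n) → FreeAlgebra K (I s × I n) → Prop
  | opp (α : I s) (b : I n) : AbarRel s n (FreeAlgebra.ι K (α, b))
      ((-1 : K) ^ (par α + par b) • FreeAlgebra.ι K (opp α, opp b))
  | rtt (u : I n × I n) (v : I s × I s) : AbarRel s n
      (rscal (mulM (leg1 (L₁ := I n) (freeTbar s n)) (leg2 (L₁ := I s) (freeTbar s n))) (S s) u v)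
      (mulM (lscal (S n) (leg2 (L₁ := I n) (freeTbar s n))) (leg1 (L₁ := I s) (freeTbar s n)) u v)

/-- The dual quantum coordinate superalgebra `Ā_{s,n}`. -/
abbrev Abar (s n : ℕ) : Type := RingQuot (AbarRel s n)

/-- The generators `t̄_{αb}`. -/
def tbar (s n : ℕ) (α : I s) (b : I n) : Abar s n :=
  RingQuot.mkAlgHom K (AbarRel s n) (FreeAlgebra.ι K (α, b))

/-- `T̄ = ∑ (-1)^{|b|(|α|+|b|)} E_{bα} ⊗ t̄_{αb}`. -/
def Tbar (s n : ℕ) : Matrix (I n) (I s) (Abar s n) :=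
  fun b α => (-1 : K) ^ (par b * (par α + par b)) • tbar s n α b

/-! ### The parity gradings -/

/-- The part of parity `ε` of `A_{r,n}`: the span of the monomials in the generators `t_{ia}`, of
parity `|i| + |a|`, that have total parity `ε`. -/
def gradeA (r n : ℕ) (ε : ZMod 2) : Submodule K (A r n) :=
  Submodule.span K {x | ∃ w : List (I r × I n),
    (w.map fun p => ((par p.1 + par p.2 : ℕ) : ZMod 2)).sum = ε ∧
      (w.map fun p => T r n p.1 p.2).prod = x}

/-- The part of parity `ε` of `Ā_{s,n}`. -/
def gradeAbar (s n : ℕ) (ε : ZMod 2) : Submodule K (Abar s n) :=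
  Submodule.span K {x | ∃ w : List (I s × I n),
    (w.map fun p => ((par p.1 + par p.2 : ℕ) : ZMod 2)).sum = ε ∧
      (w.map fun p => tbar s n p.1 p.2).prod = x}

/-- The part of parity `ε` of the tensor product of two graded spaces. -/
def gradeTensor {B C : Type} [AddCommMonoid B] [Module K B] [AddCommMonoid C] [Module K C]
    (P : ZMod 2 → Submodule K B) (Q : ZMod 2 → Submodule K C) (ε : ZMod 2) :
    Submodule K (B ⊗[K] C) :=
  Submodule.span K {z | ∃ δ η : ZMod 2, δ + η = ε ∧ ∃ x ∈ P δ, ∃ y ∈ Q η, x ⊗ₜ[K] y = z}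

/-! ### The associativity diagrams and the braided multiplication -/

section Braided

variable {B C : Type} [Semiring B] [Algebra K B] [Semiring C] [Algebra K C]

/-- `Υ ∘ (1 ⊗ mul) = (mul ⊗ 1) ∘ (1 ⊗ Υ) ∘ (Υ ⊗ 1)` on `C ⊗ B ⊗ B`. -/
def Diagram1 (Υ : C ⊗[K] B →ₗ[K] B ⊗[K] C) : Prop :=
  Υ ∘ₗ (LinearMap.mul' K B).lTensor C =
    (LinearMap.mul' K B).rTensor C ∘ₗ (TensorProduct.assoc K B B C).symm.toLinearMap ∘ₗ
      Υ.lTensor B ∘ₗ (TensorProduct.assoc K B C B).toLinearMap ∘ₗ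
        Υ.rTensor B ∘ₗ (TensorProduct.assoc K C B B).symm.toLinearMap

/-- `Υ ∘ (mul ⊗ 1) = (1 ⊗ mul) ∘ (Υ ⊗ 1) ∘ (1 ⊗ Υ)` on `C ⊗ C ⊗ B`. -/
def Diagram2 (Υ : C ⊗[K] B →ₗ[K] B ⊗[K] C) : Prop :=
  Υ ∘ₗ (LinearMap.mul' K C).rTensor B =
    (LinearMap.mul' K C).lTensor B ∘ₗ (TensorProduct.assoc K B C C).toLinearMap ∘ₗ
      Υ.rTensor C ∘ₗ (TensorProduct.assoc K C B C).symm.toLinearMap ∘ₗ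
        Υ.lTensor C ∘ₗ (TensorProduct.assoc K C C B).toLinearMap

/-- The multiplication `(mul ⊗ mul) ∘ (id ⊗ Υ ⊗ id)` on `B ⊗ C`. -/
def braidedMul (Υ : C ⊗[K] B →ₗ[K] B ⊗[K] C) :
    (B ⊗[K] C) ⊗[K] (B ⊗[K] C) →ₗ[K] B ⊗[K] C :=
  TensorProduct.map (LinearMap.mul' K B) (LinearMap.mul' K C) ∘ₗ
    (TensorProduct.assoc K B B (C ⊗[K] C)).symm.toLinearMap ∘ₗ
      ((TensorProduct.assoc K B C C).toLinearMap ∘ₗ Υ.rTensor C ∘ₗ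
        (TensorProduct.assoc K C B C).symm.toLinearMap).lTensor B ∘ₗ
          (TensorProduct.assoc K B C (B ⊗[K] C)).toLinearMap

end Braided

end QueerSuper

end

/-! Let P be the graded flip and R = P S. The map `unsign` twists the entries of even supermatrices
by signs so that their products become ordinary matrix products. In these terms R satisfies the
braid relation (`R_braid`) and the Hecke relation R² = ξR + 1 (`R_mul_self`), whence R⁻¹ = R - ξ.
The quadratic relations of the two algebras say that R can be moved from the left to the right of
T¹T² (`rtt_iff`) and of T̄²T̄¹ (`rtt_bar_iff`).

Property 3 prescribes Υ on products of entries of T̄ and T₊. Since these entries generate the two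
algebras (`adjoin_T`, `adjoin_Tbar`), the task is to extend the prescription consistently, and this
takes two steps.

In the algebra of the t's: write Υ(T̄_y ⊗ f) = ∑ Θ(f)_{yz} ⊗ T̄_z. The first diagram asks Θ to be
multiplicative, so Θ should be a homomorphism from A to matrices over A whose value on T₊ is read
off property 3. Moving T̄ past two T's produces R⁻¹₁₂R⁻¹₂₃, and R passes through this by the braid
relation (`Rinv_Rinv_R`, `exchange_rtt`). Only positive rows are prescribed; the others are forced
by t_{ia} = t_{-i,-a}. That the quadratic relation need only be tested on positive rows
(`eq_of_pos_rows`) rests on the behaviour of R under negation of one index (`R_opp_snd`,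
`R_opp_fst`).

In the algebra of the t̄'s: the second diagram asks for an action ρ of Ā on A ⊗ Ā in which T̄_y
sends f ⊗ c to ∑ Θ(f)_{yz} ⊗ T̄_z c. Moving two T̄'s past one T produces R⁻¹₂₃R⁻¹₁₂ on the row
indices of T̄ and merely a parity sign on its column indices. Both commute with R (`rowR_commute`,
`colR_commute`), so the operators satisfy the relations of T̄ (`actMatrix_rtt`).

Then Υ(c ⊗ f) = ρ(c)(f ⊗ 1). The diagrams, the unit conditions and associativity are formal
consequences of Θ and ρ being homomorphisms, and Υ is even because R preserves total parity. -/

noncomputable section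

namespace QueerSuper

/-! ### Signs -/

/-- The parity of an index, as an element of `ℤ/2`. -/
def pr {ι : Type} [HasParity ι] (i : ι) : ZMod 2 := (par i : ZMod 2)

/-- The sign `(-1)^x`. -/
def sg (x : ZMod 2) : K := if x = 0 then 1 else -1

@[simp] theorem sg_zero : sg 0 = 1 := by simp [sg]

@[simp] theorem sg_one : sg 1 = -1 := by simp [sg]

theorem zmod_two_cases (x : ZMod 2) : x = 0 ∨ x = 1 := by
  revert x; decide

theorem sg_add (x y : ZMod 2) : sg (x + y) = sg x * sg y := by
  rcases zmod_two_cases x with rfl | rfl <;> rcases zmod_two_cases y with rfl | rfl <;>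
    simp [CharTwo.add_self_eq_zero]

theorem sg_mul_self (x : ZMod 2) : sg x * sg x = 1 := by
  rcases zmod_two_cases x with rfl | rfl <;> simp

theorem sg_mul_sg_mul (x : ZMod 2) (c : K) : sg x * (sg x * c) = c := by
  rw [← mul_assoc, sg_mul_self, one_mul]

theorem sg_ne_zero (x : ZMod 2) : sg x ≠ 0 := by
  intro h
  simpa [h] using sg_mul_self x

theorem neg_one_pow_eq_sg (m : ℕ) : (-1 : K) ^ m = sg m := by
  induction m with
  | zero => simp
  | succ m ih => rw [pow_succ, ih, Nat.cast_succ, sg_add]; simp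

@[simp] theorem cast_par {ι : Type} [HasParity ι] (i : ι) : ((par i : ℕ) : ZMod 2) = pr i := rfl

@[simp] theorem opp_opp {N : ℕ} (i : I N) : opp (opp i) = i := by simp [opp]

@[simp] theorem opp_val {N : ℕ} (i : I N) : (opp i).1 = -i.1 := rfl

theorem val_ne_zero {N : ℕ} (i : I N) : i.1 ≠ 0 := (Finset.mem_erase.1 i.2).1

theorem opp_ne_self {N : ℕ} (i : I N) : opp i ≠ i := by
  intro h
  have h1 := congrArg Subtype.val h
  have h2 := val_ne_zero i
  simp at h1
  omega

theorem opp_eq_iff {N : ℕ} (i j : I N) : opp i = j ↔ i = opp j :=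
  ⟨fun h => by rw [← h, opp_opp], fun h => by rw [h, opp_opp]⟩

/-- Negation of indices as a permutation. -/
def oppEquiv (N : ℕ) : I N ≃ I N := ⟨opp, opp, opp_opp, opp_opp⟩

theorem pr_eq {N : ℕ} (i : I N) : pr i = if 0 < i.1 then 0 else 1 := by
  simp only [pr, par, HasParity.par]; split_ifs <;> simp

@[simp] theorem pr_opp {N : ℕ} (i : I N) : pr (opp i) = pr i + 1 := by
  have := val_ne_zero i
  rw [pr_eq, pr_eq, opp_val]
  split_ifs <;> first | omega | decide

theorem pr_of_pos {N : ℕ} {i : I N} (h : 0 < i.1) : pr i = 0 := by rw [pr_eq, if_pos h]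

theorem pr_pos {N : ℕ} (i : IPos N) : pr i = 0 := pr_of_pos i.2

theorem q_ne_zero : q ≠ 0 := RatFunc.X_ne_zero

/-! ### Entries of `S` -/

theorem sum_offdiag_apply {N : ℕ} (i j k l : I N) :
    (∑ i' : I N, ∑ j' : I N, if i' < j' then
        (-1 : K) ^ par i' • (E j' i' i' j' + E (opp j') (opp i') i' j') else 0) (i, j) (k, l) =
      sg (pr j) * ((if j < i ∧ k = j ∧ l = i then 1 else 0) +
        (if j < opp i ∧ k = opp j ∧ l = opp i then 1 else 0)) := by
  have h : ∀ i' j' : I N, (if i' < j' then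
        (-1 : K) ^ par i' • (E j' i' i' j' + E (opp j') (opp i') i' j') else 0) (i, j) (k, l) =
      (if i' = j then if j' = i then if j < i ∧ k = j ∧ l = i then sg (pr j) else 0 else 0 else 0) +
      (if i' = j then if j' = opp i then if j < opp i ∧ k = opp j ∧ l = opp i then sg (pr j)
        else 0 else 0 else 0) := by
    intro i' j'
    have e : opp j' = i ↔ j' = opp i := opp_eq_iff _ _
    by_cases h1 : i' = j
    · subst h1
      by_cases h2 : i' < j'
      · by_cases h3 : j' = i
        · subst h3
          have : j' ≠ opp j' := (opp_ne_self j').symm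
          simp [h2, E, Matrix.single_apply, neg_one_pow_eq_sg, this, eq_comm]
        · by_cases h4 : j' = opp i
          · subst h4
            have : i ≠ opp i := (opp_ne_self i).symm
            simp [h2, E, Matrix.single_apply, neg_one_pow_eq_sg, this, eq_comm]
          · simp [h2, E, h3, h4, e]
      · by_cases h3 : j' = i
        · subst h3
          simp [h2, (opp_ne_self j').symm]
        · by_cases h4 : j' = opp i
          · subst h4
            simp [h2, opp_ne_self]
          · simp [h2, h3, h4]
    · by_cases h2 : i' < j' <;> simp [h1, h2, E]
  simp only [Matrix.sum_apply, h, Finset.sum_add_distrib]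
  rw [mul_add, mul_ite, mul_ite]
  simp

theorem sum_diag_apply {N : ℕ} (c : I N → I N → K) (i j k l : I N) :
    (∑ i' : I N, ∑ j' : I N, c i' j' • E i' i' j' j') (i, j) (k, l) =
      if k = i ∧ l = j then c i j else 0 := by
  have h : ∀ i' j' : I N, (c i' j' • E i' i' j' j') (i, j) (k, l) =
      if i' = i then if j' = j then if k = i ∧ l = j then c i j else 0 else 0 else 0 := by
    intro i' j'
    by_cases h1 : i' = i
    · by_cases h2 : j' = j
      · subst h1 h2
        simp [E, Matrix.single_apply, eq_comm]
      · simp [E, h2]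
    · simp [E, h1]
  simp only [Matrix.sum_apply, h]
  simp

theorem S_apply {N : ℕ} (i j k l : I N) : S N (i, j) (k, l) =
    (if k = i ∧ l = j then q ^ φ i j else 0) +
      ξ * (sg (pr j) * ((if j < i ∧ k = j ∧ l = i then 1 else 0) +
        (if j < opp i ∧ k = opp j ∧ l = opp i then 1 else 0))) := by
  rw [S, Matrix.add_apply, Matrix.smul_apply, sum_offdiag_apply, sum_diag_apply, smul_eq_mul]

theorem Sinv_apply {N : ℕ} (i j k l : I N) : Sinv N (i, j) (k, l) =
    (if k = i ∧ l = j then q ^ (-φ i j) else 0) -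
      ξ * (sg (pr j) * ((if j < i ∧ k = j ∧ l = i then 1 else 0) +
        (if j < opp i ∧ k = opp j ∧ l = opp i then 1 else 0))) := by
  rw [Sinv, Matrix.sub_apply, Matrix.smul_apply, sum_offdiag_apply, sum_diag_apply, smul_eq_mul]

/-! ### The braid operator on integer indices -/

section IntegerModel
variable {F : Type*} [Field F]

/-- The coefficient of the flip in the braid operator on integer indices. -/
def weightZ (q : F) (i j : ℤ) : F :=
  if i = j then (if 0 < i then q else -q⁻¹)
  else if i = -j then (if 0 < i then q else q⁻¹)
  else if i < 0 ∧ j < 0 then -1 else 1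

/-- The braid operator on the first two indices of a function of three integers. -/
def opZ12 (q : F) (f : ℤ → ℤ → ℤ → F) (i j k : ℤ) : F :=
  weightZ q i j * f j i k + (if i < j then (q - q⁻¹) * f i j k else 0)
    - (if i < -j then (q - q⁻¹) * (if 0 < j then 1 else -1) * f (-i) (-j) k else 0)

/-- The braid operator on the last two indices of a function of three integers. -/
def opZ23 (q : F) (f : ℤ → ℤ → ℤ → F) (i j k : ℤ) : F :=
  weightZ q j k * f i k j + (if j < k then (q - q⁻¹) * f i j k else 0)
    - (if j < -k then (q - q⁻¹) * (if 0 < k then 1 else -1) * f i (-j) (-k) else 0)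

-- Both sides are combinations of values of `f` at signed permutations of `(i, j, k)`, with
-- coefficients that depend only on signs and on the relative position of the indices and their
-- negatives. There are finitely many such configurations, and each leaves an identity in `q` and
-- `q⁻¹`.
set_option maxHeartbeats 4000000 in
theorem braidZ (q : F) (hq : q ≠ 0) (f : ℤ → ℤ → ℤ → F) (i j k : ℤ) (hi : i ≠ 0) (hj : j ≠ 0)
    (hk : k ≠ 0) :
    opZ12 q (opZ23 q (opZ12 q f)) i j k = opZ23 q (opZ12 q (opZ23 q f)) i j k := by
  have hi' : i < 0 ∨ 0 < i := by omega
  have hj' : j < 0 ∨ 0 < j := by omega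
  have hk' : k < 0 ∨ 0 < k := by omega
  -- The lines j = i and j = -i cut the plane into four open regions. Together with the signs, the
  -- region decides every condition in `opZ12` and `opZ23`.
  have hij : j = i ∨ j = -i ∨ (i < j ∧ i < -j) ∨ (i < j ∧ -j < i) ∨ (j < i ∧ i < -j) ∨
    (j < i ∧ -j < i) := by omega
  clear hi hj hk
  rcases hi' with hi' | hi' <;> rcases hj' with hj' | hj' <;> rcases hk' with hk' | hk' <;>
  rcases hij with hij | hij | hij | hij | hij | hij <;> try (exfalso; omega)
  all_goals
    have hik : k = i ∨ k = -i ∨ (i < k ∧ i < -k) ∨ (i < k ∧ -k < i) ∨ (k < i ∧ i < -k) ∨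
      (k < i ∧ -k < i) := by omega
    rcases hik with hik | hik | hik | hik | hik | hik <;> try (exfalso; omega)
  all_goals
    have hjk : k = j ∨ k = -j ∨ (j < k ∧ j < -k) ∨ (j < k ∧ -k < j) ∨ (k < j ∧ j < -k) ∨
      (k < j ∧ -k < j) := by omega
    rcases hjk with hjk | hjk | hjk | hjk | hjk | hjk <;> try (exfalso; omega)
  all_goals
    try subst hij
    try subst hik
    try subst hjk
    simp (disch := omega) only [opZ12, opZ23, weightZ, ↓if_pos, ↓if_neg, neg_neg] <;>
    clear * - hq <;> grind

theorem heckeZ (q : F) (hq : q ≠ 0) (f : ℤ → ℤ → ℤ → F) (i j k : ℤ) (hi : i ≠ 0) (hj : j ≠ 0) :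
    opZ12 q (opZ12 q f) i j k = (q - q⁻¹) * opZ12 q f i j k + f i j k := by
  have hi' : i < 0 ∨ 0 < i := by omega
  have hj' : j < 0 ∨ 0 < j := by omega
  have hij : j = i ∨ j = -i ∨ (i < j ∧ i < -j) ∨ (i < j ∧ -j < i) ∨ (j < i ∧ i < -j) ∨
    (j < i ∧ -j < i) := by omega
  clear hi hj
  rcases hi' with hi' | hi' <;> rcases hj' with hj' | hj' <;>
  rcases hij with hij | hij | hij | hij | hij | hij <;> try (exfalso; omega)
  all_goals
    try subst hij
    simp (disch := omega) only [opZ12, weightZ, ↓if_pos, ↓if_neg]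
    clear * - hq
    grind

end IntegerModel

/-! ### The braid matrix -/

/-- The matrix `P S`, with `P` the graded flip, as an ordinary matrix. -/
def R (N : ℕ) : Matrix (I N × I N) (I N × I N) K := fun u v =>
  (if v = (u.2, u.1) then weightZ q u.1.1 u.2.1 else 0) +
    (if v = u then if u.1 < u.2 then ξ else 0 else 0) -
    (if v = (opp u.1, opp u.2) then if u.1 < opp u.2 then ξ * sg (pr u.2) else 0 else 0)

/-- The inverse of `R`. -/
def Rinv (N : ℕ) : Matrix (I N × I N) (I N × I N) K := R N - ξ • 1

theorem lt_iff_val {N : ℕ} (i j : I N) : i < j ↔ i.1 < j.1 := Iff.rfl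

theorem sg_pr {N : ℕ} (i : I N) : sg (pr i) = if 0 < i.1 then 1 else -1 := by
  rw [pr_eq]; split_ifs <;> simp

theorem R_mulVec {N : ℕ} (f : ℤ → ℤ → ℤ → K) (k : ℤ) (u : I N × I N) :
    (R N).mulVec (fun v => f v.1.1 v.2.1 k) u = opZ12 q f u.1.1 u.2.1 k := by
  rw [opZ12, show q - q⁻¹ = ξ from rfl]
  simp only [Matrix.mulVec, dotProduct, R, sub_mul, add_mul, ite_mul, zero_mul,
    Finset.sum_sub_distrib, Finset.sum_add_distrib, Finset.sum_ite_eq', Finset.mem_univ, if_true,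
    lt_iff_val, opp_val, sg_pr]

theorem R_mulVec' {N : ℕ} (f : ℤ → ℤ → ℤ → K) (k : ℤ) (u : I N × I N) :
    (R N).mulVec (fun v => f k v.1.1 v.2.1) u = opZ23 q f k u.1.1 u.2.1 := by
  rw [opZ23, show q - q⁻¹ = ξ from rfl]
  simp only [Matrix.mulVec, dotProduct, R, sub_mul, add_mul, ite_mul, zero_mul,
    Finset.sum_sub_distrib, Finset.sum_add_distrib, Finset.sum_ite_eq', Finset.mem_univ, if_true,
    lt_iff_val, opp_val, sg_pr]

/-! ### Operators on two adjacent legs of a triple tensor product -/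

section Legs
variable {ι : Type} [DecidableEq ι] {B : Type} [CommSemiring B]

/-- The matrix `M ⊗ 1` on a triple tensor product. -/
def leg12 (M : Matrix (ι × ι) (ι × ι) B) : Matrix (ι × ι × ι) (ι × ι × ι) B :=
  fun u v => if u.2.2 = v.2.2 then M (u.1, u.2.1) (v.1, v.2.1) else 0

/-- The matrix `1 ⊗ M` on a triple tensor product. -/
def leg23 (M : Matrix (ι × ι) (ι × ι) B) : Matrix (ι × ι × ι) (ι × ι × ι) B :=
  fun u v => if u.1 = v.1 then M u.2 v.2 else 0

theorem leg12_mul [Fintype ι] (M M' : Matrix (ι × ι) (ι × ι) B) :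
    leg12 (M * M') = leg12 M * leg12 M' := by
  ext ⟨i, j, k⟩ ⟨a, b, c⟩
  by_cases h : k = c
  · simp [leg12, Matrix.mul_apply, Fintype.sum_prod_type, h]
  · simp [leg12, Matrix.mul_apply, Fintype.sum_prod_type, h]

theorem leg23_mul [Fintype ι] (M M' : Matrix (ι × ι) (ι × ι) B) :
    leg23 (M * M') = leg23 M * leg23 M' := by
  ext ⟨i, j, k⟩ ⟨a, b, c⟩
  by_cases h : i = a
  · simp [leg23, Matrix.mul_apply, Fintype.sum_prod_type, h]
  · simp [leg23, Matrix.mul_apply, Fintype.sum_prod_type, h]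

theorem leg12_one : leg12 (1 : Matrix (ι × ι) (ι × ι) B) = 1 := by
  ext ⟨i, j, k⟩ ⟨a, b, c⟩
  simp [leg12, Matrix.one_apply]
  grind

theorem leg23_one : leg23 (1 : Matrix (ι × ι) (ι × ι) B) = 1 := by
  ext ⟨i, j, k⟩ ⟨a, b, c⟩
  simp [leg23, Matrix.one_apply]
  grind

theorem leg12_mulVec [Fintype ι] (M : Matrix (ι × ι) (ι × ι) B) (f : ι × ι × ι → B)
    (u : ι × ι × ι) :
    (leg12 M).mulVec f u = M.mulVec (fun v => f (v.1, v.2, u.2.2)) (u.1, u.2.1) := by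
  simp [leg12, Matrix.mulVec, dotProduct, Fintype.sum_prod_type]

theorem leg23_mulVec [Fintype ι] (M : Matrix (ι × ι) (ι × ι) B) (f : ι × ι × ι → B)
    (u : ι × ι × ι) :
    (leg23 M).mulVec f u = M.mulVec (fun v => f (u.1, v.1, v.2)) u.2 := by
  simp [leg23, Matrix.mulVec, dotProduct, Fintype.sum_prod_type]

end Legs

/-- Transfers identities from the integer operators, where all side conditions are linear
inequalities, to matrices over `I N`. -/
theorem exists_extend {N : ℕ} (f : I N × I N × I N → K) :
    ∃ g : ℤ → ℤ → ℤ → K, f = fun u => g u.1.1 u.2.1.1 u.2.2.1 := by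
  classical
  refine ⟨fun i j k => if h : i ∈ (Finset.Icc (-(N : ℤ)) N).erase 0 ∧
    j ∈ (Finset.Icc (-(N : ℤ)) N).erase 0 ∧ k ∈ (Finset.Icc (-(N : ℤ)) N).erase 0 then
      f (⟨i, h.1⟩, ⟨j, h.2.1⟩, ⟨k, h.2.2⟩) else 0, ?_⟩
  funext u
  have h := And.intro u.1.2 (And.intro u.2.1.2 u.2.2.2)
  change f u = dite _ _ _
  rw [dif_pos h]

theorem R_braid (N : ℕ) :
    leg12 (R N) * leg23 (R N) * leg12 (R N) = leg23 (R N) * leg12 (R N) * leg23 (R N) := by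
  have h12 : ∀ g : ℤ → ℤ → ℤ → K, (leg12 (R N)).mulVec (fun u => g u.1.1 u.2.1.1 u.2.2.1) =
      fun u => opZ12 q g u.1.1 u.2.1.1 u.2.2.1 := fun g => by
    funext u
    rw [leg12_mulVec]
    exact R_mulVec g u.2.2.1 (u.1, u.2.1)
  have h23 : ∀ g : ℤ → ℤ → ℤ → K, (leg23 (R N)).mulVec (fun u => g u.1.1 u.2.1.1 u.2.2.1) =
      fun u => opZ23 q g u.1.1 u.2.1.1 u.2.2.1 := fun g => by
    funext u
    rw [leg23_mulVec]
    exact R_mulVec' g u.1.1 u.2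
  apply Matrix.mulVec_injective
  funext f
  obtain ⟨g, rfl⟩ := exists_extend f
  simp only [← Matrix.mulVec_mulVec, h12, h23]
  funext u
  exact braidZ q q_ne_zero g _ _ _ (val_ne_zero _) (val_ne_zero _) (val_ne_zero _)

theorem R_mul_self (N : ℕ) : R N * R N = ξ • R N + 1 := by
  have h12 : ∀ g : ℤ → ℤ → ℤ → K, (R N).mulVec (fun u => g u.1.1 u.2.1 0) =
      fun u => opZ12 q g u.1.1 u.2.1 0 := fun g => by
    funext u
    exact R_mulVec g _ _
  apply Matrix.mulVec_injective
  funext f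
  -- The third index plays no role here; any element `k` serves to view `f` as a function of three
  -- indices. Without such an element there is nothing to prove.
  rcases isEmpty_or_nonempty (I N) with h | ⟨⟨k⟩⟩
  · funext u
    exact (h.false u.1).elim
  · obtain ⟨g, hg⟩ := exists_extend (fun u : I N × I N × I N => f (u.1, u.2.1))
    obtain rfl : f = fun u => (fun i j _ => g i j k.1) u.1.1 u.2.1 (0 : ℤ) := by
      funext u
      exact congrFun hg (u.1, u.2, k)
    simp only [← Matrix.mulVec_mulVec, Matrix.add_mulVec, Matrix.smul_mulVec, Matrix.one_mulVec]
    rw [h12 fun i j _ => g i j k.1, h12]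
    funext u
    exact heckeZ q q_ne_zero _ _ _ _ (val_ne_zero _) (val_ne_zero _)

theorem R_mul_Rinv (N : ℕ) : R N * Rinv N = 1 := by
  rw [Rinv, mul_sub, R_mul_self, mul_smul_comm, mul_one, add_sub_cancel_left]

theorem Rinv_mul_R (N : ℕ) : Rinv N * R N = 1 := by
  rw [Rinv, sub_mul, R_mul_self, smul_mul_assoc, one_mul, add_sub_cancel_left]

theorem leg12_Rinv_mul (N : ℕ) : leg12 (Rinv N) * leg12 (R N) = 1 := by
  rw [← leg12_mul, Rinv_mul_R, leg12_one]

theorem leg12_mul_Rinv (N : ℕ) : leg12 (R N) * leg12 (Rinv N) = 1 := by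
  rw [← leg12_mul, R_mul_Rinv, leg12_one]

theorem leg23_Rinv_mul (N : ℕ) : leg23 (Rinv N) * leg23 (R N) = 1 := by
  rw [← leg23_mul, Rinv_mul_R, leg23_one]

theorem leg23_mul_Rinv (N : ℕ) : leg23 (R N) * leg23 (Rinv N) = 1 := by
  rw [← leg23_mul, R_mul_Rinv, leg23_one]

/-- In a group the braid relation says that conjugation by x⁻¹y⁻¹ carries x to y. -/
theorem braid_inv_left {G : Type*} [Monoid G] {x y x' y' : G} (h : x * y * x = y * x * y)
    (hx : x' * x = 1) (hx' : x * x' = 1) (hy : y' * y = 1) (hy' : y * y' = 1) :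
    x' * y' * x = y * x' * y' := by
  let ux : Gˣ := ⟨x, x', hx', hx⟩
  let uy : Gˣ := ⟨y, y', hy', hy⟩
  have h' : ux * uy * ux = uy * ux * uy := Units.ext h
  have : ux⁻¹ * uy⁻¹ * ux = uy * ux⁻¹ * uy⁻¹ := by
    calc ux⁻¹ * uy⁻¹ * ux = ux⁻¹ * uy⁻¹ * (ux * uy * ux) * (ux⁻¹ * uy⁻¹) := by group
      _ = ux⁻¹ * uy⁻¹ * (uy * ux * uy) * (ux⁻¹ * uy⁻¹) := by rw [h']
      _ = uy * ux⁻¹ * uy⁻¹ := by group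
  exact congrArg Units.val this

/-- Two inverse crossings move past a crossing to the left. -/
theorem Rinv_Rinv_R (N : ℕ) : leg12 (Rinv N) * leg23 (Rinv N) * leg12 (R N) =
    leg23 (R N) * (leg12 (Rinv N) * leg23 (Rinv N)) := by
  rw [← mul_assoc]
  exact braid_inv_left (R_braid N) (leg12_Rinv_mul N) (leg12_mul_Rinv N) (leg23_Rinv_mul N)
    (leg23_mul_Rinv N)

/-- Two inverse crossings move past a crossing to the right. -/
theorem Rinv_Rinv_R' (N : ℕ) : leg23 (Rinv N) * leg12 (Rinv N) * leg23 (R N) =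
    leg12 (R N) * (leg23 (Rinv N) * leg12 (Rinv N)) := by
  rw [← mul_assoc]
  exact braid_inv_left (R_braid N).symm (leg23_Rinv_mul N) (leg23_mul_Rinv N) (leg12_Rinv_mul N)
    (leg12_mul_Rinv N)

/-! ### Parity and symmetry of the braid matrix -/

/-- Each of the three terms preserves total parity: one permutes the indices, one fixes them, and
one negates both, which flips both parities. -/
theorem R_even {N : ℕ} {u v : I N × I N} (h : pr u.1 + pr u.2 ≠ pr v.1 + pr v.2) :
    R N u v = 0 := by
  have h1 : v ≠ (u.2, u.1) := by rintro rfl; exact h (add_comm _ _)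
  have h2 : v ≠ u := by rintro rfl; exact h rfl
  have h3 : v ≠ (opp u.1, opp u.2) := by
    rintro rfl
    apply h
    simp only [pr_opp]
    generalize pr u.1 = x
    generalize pr u.2 = y
    revert x y
    decide
  simp [R, h1, h2, h3]

theorem Rinv_even {N : ℕ} {u v : I N × I N} (h : pr u.1 + pr u.2 ≠ pr v.1 + pr v.2) :
    Rinv N u v = 0 := by
  have h2 : u ≠ v := by rintro rfl; exact h rfl
  simp [Rinv, R_even h, h2]

/-- The term that negates both indices requires i < -j, which fails for positive i and j. Hence the
rows of T₊ satisfy a closed system of quadratic relations. -/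
theorem R_pos {N : ℕ} {u v : I N × I N} (h1 : 0 < u.1.1) (h2 : 0 < u.2.1)
    (h : R N u v ≠ 0) : 0 < v.1.1 ∧ 0 < v.2.1 := by
  by_contra hv
  apply h
  have e1 : v ≠ (u.2, u.1) := by rintro rfl; exact hv ⟨h2, h1⟩
  have e2 : v ≠ u := by rintro rfl; exact hv ⟨h1, h2⟩
  have e3 : ¬ u.1 < opp u.2 := by rw [lt_iff_val, opp_val]; omega
  simp [R, e1, e2, e3]

theorem weightZ_neg {N : ℕ} (i j : I N) :
    weightZ q i.1 (-j.1) = sg (pr i) * weightZ q i.1 j.1 := by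
  have hi := val_ne_zero i
  have hj := val_ne_zero j
  rw [sg_pr]
  unfold weightZ
  grind

/-- Up to signs, R intertwines negation on one tensor factor with negation on the other. It reflects
the shape E_{ji} + E_{-j,-i} of the first factor in `S`: the flip then carries the negation to the
other side. -/
theorem R_opp_snd {N : ℕ} (i j k l : I N) :
    R N (i, opp j) (k, l) = sg (pr i + pr j + pr k + 1) * R N (i, j) (opp k, l) := by
  have h1 : (if (k, l) = (opp j, i) then weightZ q i.1 (opp j).1 else 0) =
      sg (pr i + pr j + pr k + 1) * (if (opp k, l) = (j, i) then weightZ q i.1 j.1 else 0) := by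
    simp only [Prod.mk.injEq, opp_eq_iff]
    split_ifs with h
    · obtain ⟨rfl, rfl⟩ := h
      simp only [opp_val, weightZ_neg, pr_opp, sg_add, sg_one]
      grind [sg_mul_self]
    · simp
  have h2 : (if (k, l) = (i, opp j) then if i < opp j then ξ else 0 else 0) =
      -(sg (pr i + pr j + pr k + 1) * (if (opp k, l) = (opp i, opp j) then
        if i < opp j then ξ * sg (pr j) else 0 else 0)) := by
    simp only [Prod.mk.injEq, opp_eq_iff, opp_opp]
    split_ifs with h h'
    · obtain ⟨rfl, rfl⟩ := h
      simp only [sg_add, sg_one]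
      grind [sg_mul_self]
    · simp
    · simp
  have h3 : (if (k, l) = (opp i, opp (opp j)) then if i < opp (opp j) then ξ * sg (pr (opp j))
        else 0 else 0) = -(sg (pr i + pr j + pr k + 1) * (if (opp k, l) = (i, j) then
        if i < j then ξ else 0 else 0)) := by
    simp only [Prod.mk.injEq, opp_eq_iff, opp_opp]
    split_ifs with h h'
    · obtain ⟨rfl, rfl⟩ := h
      simp only [pr_opp, sg_add, sg_one]
      grind [sg_mul_self]
    · simp
    · simp
  simp only [R, h1, h2, h3]
  ring

theorem val_eq_iff {N : ℕ} (i j : I N) : i = j ↔ i.1 = j.1 := Subtype.ext_iff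

/-- The opposite intertwining holds exactly for R⁻¹. As R = R⁻¹ + ξ, it holds for R up to ξ times
the difference of the two negations, as in a Hecke-Clifford algebra. -/
theorem R_opp_fst {N : ℕ} (i j k l : I N) :
    R N (opp i, j) (k, l) = sg (pr i + pr k + pr l + 1) * R N (i, j) (k, opp l) +
      (if k = opp i ∧ l = j then ξ else 0) - (if k = i ∧ l = opp j then ξ * sg (pr j) else 0) := by
  have h1 : (if (k, l) = (j, opp i) then weightZ q (opp i).1 j.1 else 0) =
      sg (pr i + pr k + pr l + 1) * (if (k, opp l) = (j, i) then weightZ q i.1 j.1 else 0) +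
      (if k = j ∧ l = opp i then (if i = opp j then ξ else 0) - (if i = j then ξ * sg (pr j) else 0)
        else 0) := by
    simp only [Prod.mk.injEq, opp_eq_iff]
    by_cases h : k = j ∧ l = opp i
    · obtain ⟨rfl, rfl⟩ := h
      have hi := val_ne_zero i
      have hk := val_ne_zero k
      simp only [opp_val, pr_opp, sg_add, sg_one, sg_pr, val_eq_iff, and_self, if_true, ξ]
      generalize i.1 = i at *
      generalize k.1 = k at *
      unfold weightZ
      grind
    · simp [h]
  -- The condition -i < j is the negation of i ≤ -j. This produces the correction term ξ, while the
  -- boundary case i = -j is absorbed by the weights in `h1`. The next identity treats i ≤ j in the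
  -- same way.
  have h2 : (if (k, l) = (opp i, j) then if opp i < j then ξ else 0 else 0) =
      -(sg (pr i + pr k + pr l + 1) * (if (k, opp l) = (opp i, opp j) then
        if i < opp j then ξ * sg (pr j) else 0 else 0)) +
      (if k = opp i ∧ l = j then ξ else 0) -
      (if k = j ∧ l = opp i then (if i = opp j then ξ else 0) else 0) := by
    by_cases h : k = opp i ∧ l = j
    · obtain ⟨rfl, rfl⟩ := h
      have e : (opp i = l ∧ l = opp i) ↔ i = opp l :=
        ⟨fun h => (opp_eq_iff _ _).1 h.1,
          fun h => ⟨(opp_eq_iff _ _).2 h, ((opp_eq_iff _ _).2 h).symm⟩⟩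
      have hi := sg_mul_self (pr i)
      have hl := sg_mul_self (pr l)
      simp only [and_self, if_true, e, pr_opp, sg_add, sg_one]
      simp only [val_eq_iff, lt_iff_val, opp_val]
      clear * - hi hl
      generalize i.1 = i', l.1 = l', sg (pr i) = s, sg (pr l) = t at *
      grind
    · have h' : ¬ (k = opp i ∧ opp l = opp j) := by simpa [opp_eq_iff] using h
      have e : k = j ∧ l = opp i → i ≠ opp j := by
        rintro ⟨rfl, rfl⟩ rfl
        simp at h
      simp only [Prod.mk.injEq, h, h', if_false]
      split_ifs <;> simp_all
  have h3 : (if (k, l) = (opp (opp i), opp j) then if opp i < opp j then ξ * sg (pr j)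
        else 0 else 0) = -(sg (pr i + pr k + pr l + 1) * (if (k, opp l) = (i, j) then
        if i < j then ξ else 0 else 0)) + (if k = i ∧ l = opp j then ξ * sg (pr j) else 0) -
      (if k = j ∧ l = opp i then (if i = j then ξ * sg (pr j) else 0) else 0) := by
    by_cases h : k = i ∧ l = opp j
    · obtain ⟨rfl, rfl⟩ := h
      have e : (k = j ∧ opp j = opp k) ↔ k = j := by
        rw [opp_eq_iff, opp_opp]; exact ⟨fun h => h.1, fun h => ⟨h, h.symm⟩⟩
      have hk := sg_mul_self (pr k)
      simp only [opp_opp, and_self, if_true, e, pr_opp, sg_add, sg_one]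
      simp only [val_eq_iff, lt_iff_val, opp_val]
      clear * - hk
      generalize k.1 = k', j.1 = j', sg (pr k) = s, sg (pr j) = t at *
      grind
    · have h' : ¬ (k = i ∧ opp l = j) := by simpa [opp_eq_iff] using h
      have e : k = j ∧ l = opp i → i ≠ j := by
        rintro ⟨rfl, rfl⟩ rfl
        simp at h
      simp only [Prod.mk.injEq, opp_opp, h, h', if_false]
      by_cases h'' : k = j ∧ l = opp i
      · rw [if_pos h'', if_neg (e h'')]
        simp
      · rw [if_neg h'']
        simp
  simp only [R, h1, h2, h3]
  by_cases h : k = j ∧ l = opp i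
  · simp only [h, and_self, if_true]
    ring
  · simp only [h, if_false]
    ring

/-! ### Comparison with `S` -/

theorem par_eq {N : ℕ} (i : I N) : par i = if 0 < i.1 then 0 else 1 := rfl

theorem weightZ_eq {N : ℕ} (i j : I N) : weightZ q j.1 i.1 = sg (pr i * pr j) * q ^ φ i j := by
  have hi := val_ne_zero i
  have hj := val_ne_zero j
  rw [φ, par_eq, pr_eq, pr_eq]
  simp only [val_eq_iff, opp_val]
  generalize i.1 = i at *
  generalize j.1 = j at *
  unfold weightZ
  by_cases hi' : 0 < i <;> by_cases hj' : 0 < j <;> by_cases h1 : i = j <;>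
    by_cases h2 : i = -j <;> try (exfalso; omega)
  all_goals
    simp (disch := omega) only [if_pos, if_neg]
    simp

/-- This is S = P R entrywise. The sign on the left is the value of `twist` on entries that preserve
total parity. -/
theorem sg_mul_S {N : ℕ} (i j k l : I N) : sg ((pr i + pr k) * pr k) * S N (i, j) (k, l) =
    sg (pr i * pr j) * R N (j, i) (k, l) := by
  have h1 : sg ((pr i + pr k) * pr k) * (if k = i ∧ l = j then q ^ φ i j else 0) =
      sg (pr i * pr j) * (if (k, l) = (i, j) then weightZ q j.1 i.1 else 0) := by
    simp only [Prod.mk.injEq]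
    split_ifs with h
    · obtain ⟨rfl, rfl⟩ := h
      rw [weightZ_eq, sg_mul_sg_mul, CharTwo.add_self_eq_zero, zero_mul, sg_zero, one_mul]
    · simp
  have h2 : sg ((pr i + pr k) * pr k) * (sg (pr j) * (if j < i ∧ k = j ∧ l = i then 1 else 0)) =
      sg (pr i * pr j) * (if (k, l) = (j, i) then if j < i then 1 else 0 else 0) := by
    by_cases h : k = j ∧ l = i
    · obtain ⟨rfl, rfl⟩ := h
      simp only [and_true, if_true]
      rw [← mul_assoc, ← sg_add]
      congr 2
      generalize pr k = x
      generalize pr l = y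
      revert x y
      decide
    · simp [h]
  have h3 : sg ((pr i + pr k) * pr k) *
      (sg (pr j) * (if j < opp i ∧ k = opp j ∧ l = opp i then 1 else 0)) =
      -(sg (pr i * pr j) * (if (k, l) = (opp j, opp i) then if j < opp i then sg (pr i) else 0
        else 0)) := by
    by_cases h : k = opp j ∧ l = opp i
    · obtain ⟨rfl, rfl⟩ := h
      simp only [and_true, if_true, pr_opp]
      rcases zmod_two_cases (pr i) with h | h <;> rcases zmod_two_cases (pr j) with h' | h' <;>
        simp [h, h', CharTwo.add_self_eq_zero] <;> split_ifs <;> simp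
    · simp [h]
  rw [S_apply]
  have h2' : (if j < i then ξ else 0 : K) = ξ * (if j < i then 1 else 0) := by simp
  have h3' : (if j < opp i then ξ * sg (pr i) else 0 : K) =
    ξ * (if j < opp i then sg (pr i) else 0) := by simp
  simp only [R, h2', h3', ← mul_ite_zero]
  linear_combination h1 + ξ * h2 + ξ * h3

/-- This is S⁻¹ = R⁻¹ P entrywise. Subtracting ξ from R replaces the condition i < j by minus the
condition j ≤ i; the case i = j is the one where flip and identity coincide, and there it turns the
weight q into q⁻¹, or -q⁻¹ into -q. -/
theorem sg_mul_Sinv {N : ℕ} (i j k l : I N) : sg ((pr i + pr k) * pr k) * Sinv N (i, j) (k, l) =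
    sg (pr k * pr l) * Rinv N (i, j) (l, k) := by
  have h1 : sg ((pr i + pr k) * pr k) * (if k = i ∧ l = j then q ^ (-φ i j) else 0) =
      sg (pr k * pr l) * ((if k = i ∧ l = j then weightZ q i.1 j.1 else 0) -
        (if k = j ∧ l = i then if i = j then ξ else 0 else 0)) := by
    by_cases h : k = i ∧ l = j
    · obtain ⟨rfl, rfl⟩ := h
      have hk := val_ne_zero k
      have hl := val_ne_zero l
      rw [φ, par_eq, pr_eq, pr_eq]
      simp only [val_eq_iff, opp_val, ξ, and_self, if_true]
      generalize k.1 = i, l.1 = j at *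
      unfold weightZ
      by_cases hi' : 0 < i <;> by_cases hj' : 0 < j <;> by_cases h1 : i = j <;>
        by_cases h2 : i = -j <;> try (exfalso; omega)
      all_goals
        simp (disch := omega) only [if_pos, if_neg]
        simp [CharTwo.add_self_eq_zero]
    · have e : k = j ∧ l = i → i ≠ j := by
        rintro ⟨rfl, rfl⟩ rfl
        simp at h
      simp only [h, if_false]
      split_ifs <;> simp_all
  have h2 : sg ((pr i + pr k) * pr k) * (sg (pr j) * (if j < i ∧ k = j ∧ l = i then 1 else 0)) =
      sg (pr k * pr l) * ((if k = j ∧ l = i then 1 else 0) -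
        (if k = j ∧ l = i then if i < j then 1 else 0 else 0) -
        (if k = j ∧ l = i then if i = j then 1 else 0 else 0)) := by
    by_cases h : k = j ∧ l = i
    · obtain ⟨rfl, rfl⟩ := h
      simp only [and_true, if_true]
      rw [← mul_assoc, ← sg_add]
      congr 1
      · congr 1
        generalize pr k = x
        generalize pr l = y
        revert x y
        decide
      · rcases lt_trichotomy k l with h | h | h
        · simp [h, h.not_gt, h.ne']
        · simp [h]
        · simp [h, h.not_gt, h.ne]
    · simp [h]
  have h3 : sg ((pr i + pr k) * pr k) *
      (sg (pr j) * (if j < opp i ∧ k = opp j ∧ l = opp i then 1 else 0)) =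
      (sg (pr k * pr l) * (if k = opp j ∧ l = opp i then if i < opp j then sg (pr j) else 0
        else 0)) := by
    by_cases h : k = opp j ∧ l = opp i
    · obtain ⟨rfl, rfl⟩ := h
      have e : j < opp i ↔ i < opp j := by simp only [lt_iff_val, opp_val]; omega
      simp only [and_true, if_true, pr_opp, e]
      rcases zmod_two_cases (pr i) with h | h <;> rcases zmod_two_cases (pr j) with h' | h' <;>
        simp [h, h', CharTwo.add_self_eq_zero]
    · simp [h]
  rw [Sinv_apply]
  have h2' : (if i < j then ξ else 0 : K) = ξ * (if i < j then 1 else 0) := by simp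
  have h3' : (if i < opp j then ξ * sg (pr j) else 0 : K) =
    ξ * (if i < opp j then sg (pr j) else 0) := by simp
  have h4' : (if i = j then ξ else 0 : K) = ξ * (if i = j then 1 else 0) := by simp
  have e1 : l = j ∧ k = i ↔ k = i ∧ l = j := and_comm
  have e2 : l = i ∧ k = j ↔ k = j ∧ l = i := and_comm
  have e3 : l = opp i ∧ k = opp j ↔ k = opp j ∧ l = opp i := and_comm
  have e4 : i = l ∧ j = k ↔ k = j ∧ l = i := by rw [eq_comm, and_comm, eq_comm (a := j)]
  simp only [h4', ← mul_ite_zero] at h1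
  simp only [Rinv, R, Matrix.sub_apply, Matrix.smul_apply, Matrix.one_apply, smul_eq_mul, h2', h3',
    Prod.mk.injEq, e1, e2, e3, e4, ← mul_ite_zero]
  linear_combination h1 - ξ * h2 - ξ * h3

/-! ### Removing the signs from products of supermatrices -/

section Unsign

variable {I₁ I₂ J₁ J₂ L₁ L₂ : Type} [HasParity I₁] [HasParity I₂] [HasParity J₁] [HasParity J₂]
  [HasParity L₁] [HasParity L₂]

/-- The exponent of the sign that turns products of even supermatrices into ordinary products. -/
def twist (u : I₁ × I₂) (v : J₁ × J₂) : ZMod 2 :=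
  (pr u.1 + pr v.1) * (pr v.1 + pr v.2) + (pr u.2 + pr v.2) * pr v.2

/-- The ordinary matrix of an even supermatrix. -/
def unsign {B : Type} [AddCommMonoid B] [Module K B] (X : Matrix (I₁ × I₂) (J₁ × J₂) B) :
    Matrix (I₁ × I₂) (J₁ × J₂) B :=
  fun u v => sg (twist u v) • X u v

theorem unsign_injective {B : Type} [AddCommMonoid B] [Module K B] :
    Function.Injective (unsign : Matrix (I₁ × I₂) (J₁ × J₂) B → _) := by
  intro X Y h
  ext u v
  have h' := congrArg (fun x => sg (twist u v) • x) (congrFun (congrFun h u) v)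
  simpa only [unsign, smul_smul, sg_mul_self, one_smul] using h'

variable [Fintype J₁] [Fintype J₂]

/-- The sign in `superMul` is the coboundary of `twist`: its exponent equals twist(u,v) + twist(v,w)
+ twist(u,w) modulo 2. No vanishing of entries is needed, as `superMul` reads the parity of
coefficients off the indices. -/
theorem unsign_superMul {B C D : Type} [AddCommMonoid B] [Module K B] [AddCommMonoid C] [Module K C]
    [AddCommMonoid D] [Module K D] (β : B →ₗ[K] C →ₗ[K] D)
    (X : Matrix (I₁ × I₂) (J₁ × J₂) B) (Y : Matrix (J₁ × J₂) (L₁ × L₂) C)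
    (u : I₁ × I₂) (w : L₁ × L₂) :
    unsign (superMul β X Y) u w = ∑ v, β (unsign X u v) (unsign Y v w) := by
  simp only [unsign, superMul, Finset.smul_sum, map_smul, LinearMap.smul_apply, smul_smul]
  refine Finset.sum_congr rfl fun v _ => ?_
  congr 1
  rw [neg_one_pow_eq_sg, ← sg_add, ← sg_add]
  congr 1
  simp only [Nat.cast_add, Nat.cast_mul, cast_par, twist]
  generalize pr u.1 = a, pr u.2 = b, pr v.1 = c, pr v.2 = d, pr w.1 = e, pr w.2 = f
  revert a b c d e f
  decide

variable {B : Type} [Semiring B] [Algebra K B]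

theorem unsign_mulM (X : Matrix (I₁ × I₂) (J₁ × J₂) B) (Y : Matrix (J₁ × J₂) (L₁ × L₂) B) :
    unsign (mulM X Y) = unsign X * unsign Y := by
  ext u w
  rw [mulM, unsign_superMul, Matrix.mul_apply]
  rfl

theorem unsign_lscal (X : Matrix (I₁ × I₂) (J₁ × J₂) K) (Y : Matrix (J₁ × J₂) (L₁ × L₂) B) :
    unsign (lscal X Y) = (unsign X).map (algebraMap K B) * unsign Y := by
  ext u w
  rw [lscal, unsign_superMul, Matrix.mul_apply]
  exact Finset.sum_congr rfl fun v _ => Algebra.smul_def _ _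

theorem unsign_rscal (X : Matrix (I₁ × I₂) (J₁ × J₂) B) (Y : Matrix (J₁ × J₂) (L₁ × L₂) K) :
    unsign (rscal X Y) = unsign X * (unsign Y).map (algebraMap K B) := by
  ext u w
  rw [rscal, unsign_superMul, Matrix.mul_apply]
  exact Finset.sum_congr rfl fun v _ => (Algebra.smul_def _ _).trans (Algebra.commutes _ _)

end Unsign

/-- The graded flip, as an ordinary matrix. -/
def flipM (N : ℕ) : Matrix (I N × I N) (I N × I N) K :=
  fun u v => if v = u.swap then sg (pr u.1 * pr u.2) else 0

theorem flipM_mul_flipM (N : ℕ) : flipM N * flipM N = 1 := by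
  ext u v
  simp only [Matrix.mul_apply, flipM, ite_mul, zero_mul, Finset.sum_ite_eq', Finset.mem_univ,
    if_true, Prod.swap_swap, Matrix.one_apply, eq_comm (a := u)]
  split_ifs
  · simp [mul_comm (pr u.2), sg_mul_self]
  · simp

theorem unsign_S (N : ℕ) : unsign (S N) = flipM N * R N := by
  ext ⟨i, j⟩ ⟨k, l⟩
  simp only [Matrix.mul_apply, flipM, ite_mul, zero_mul, Finset.sum_ite_eq', Finset.mem_univ,
    if_true, Prod.swap_prod_mk]
  rw [← sg_mul_S, unsign, smul_eq_mul]
  by_cases h : pr i + pr j = pr k + pr l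
  · congr 2
    simp only [twist]
    generalize pr i = a, pr j = b, pr k = c, pr l = d at *
    revert a b c d
    decide
  · have h0 : S N (i, j) (k, l) = 0 := by
      have h1 := sg_mul_S i j k l
      rw [R_even (by rwa [add_comm]), mul_zero] at h1
      exact (mul_eq_zero.1 h1).resolve_left (sg_ne_zero _)
    simp [h0]

/-! ### The quadratic relations in terms of ordinary matrices -/

section Ordinary
variable {B : Type} [Semiring B] [Algebra K B] {M N : ℕ}

/-- The ordinary matrix of `X^{1[3]} X^{2[3]}`. -/
def prod12 (X : Matrix (I M) (I N) B) : Matrix (I M × I M) (I N × I N) B := fun u v =>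
  sg ((pr u.1 + pr v.1) * (pr v.1 + pr u.2) + (pr u.2 + pr v.2) * pr v.2) •
    (X u.1 v.1 * X u.2 v.2)

/-- The ordinary matrix of `X^{2[3]} X^{1[3]}`. -/
def prod21 (X : Matrix (I M) (I N) B) : Matrix (I M × I M) (I N × I N) B := fun u v =>
  sg ((pr u.2 + pr v.2) * pr v.2 + (pr u.1 + pr v.1) * (pr v.1 + pr v.2)) •
    (X u.2 v.2 * X u.1 v.1)

theorem unsign_leg1_mul_leg2 (X : Matrix (I M) (I N) B) :
    unsign (leg1 (L₁ := I M) X) * unsign (leg2 (L₁ := I N) X) = prod12 X := by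
  ext ⟨i, j⟩ ⟨a, c⟩
  simp only [Matrix.mul_apply, unsign, leg1, leg2, Fintype.sum_prod_type_right, smul_ite, smul_zero,
    ite_mul, mul_ite, zero_mul, mul_zero, Finset.sum_ite_eq, Finset.sum_ite_eq', Finset.mem_univ,
    if_true, prod12, smul_mul_smul_comm, ← sg_add]
  congr 2
  simp only [twist]
  generalize pr i = i, pr j = j, pr a = a, pr c = c
  revert i j a c
  decide

theorem unsign_leg2_mul_leg1 (X : Matrix (I M) (I N) B) :
    unsign (leg2 (L₁ := I M) X) * unsign (leg1 (L₁ := I N) X) = prod21 X := by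
  ext ⟨i, j⟩ ⟨a, c⟩
  simp only [Matrix.mul_apply, unsign, leg1, leg2, Fintype.sum_prod_type, smul_ite, smul_zero,
    ite_mul, mul_ite, zero_mul, mul_zero, Finset.sum_ite_eq, Finset.sum_ite_eq', Finset.mem_univ,
    if_true, prod21, smul_mul_smul_comm, ← sg_add]
  congr 2
  simp only [twist]
  generalize pr i = i, pr j = j, pr a = a, pr c = c
  revert i j a c
  decide

theorem prod21_eq (X : Matrix (I M) (I N) B) : prod21 X =
    (flipM M).map (algebraMap K B) * prod12 X * (flipM N).map (algebraMap K B) := by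
  have h (u v : I N × I N) : flipM N u v = if u = v.swap then sg (pr v.1 * pr v.2) else 0 := by
    simp only [flipM, Prod.swap_eq_iff_eq_swap, eq_comm (a := v)]
    split_ifs with h
    · rw [h, Prod.fst_swap, Prod.snd_swap, mul_comm]
    · rfl
  ext ⟨i, j⟩ ⟨a, c⟩
  simp only [Matrix.mul_apply, Matrix.map_apply, h]
  simp only [flipM, apply_ite (algebraMap K B), map_zero, ite_mul,
    mul_ite, zero_mul, mul_zero, Finset.sum_ite_eq', Finset.mem_univ, if_true]
  rw [← Algebra.smul_def, ← Algebra.commutes, ← Algebra.smul_def, prod12, prod21]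
  simp only [smul_smul, ← sg_add, Prod.swap_prod_mk]
  congr 2
  generalize pr i = i, pr j = j, pr a = a, pr c = c
  revert i j a c
  decide

theorem map_flipM_mul_self :
    (flipM M).map (algebraMap K B) * (flipM M).map (algebraMap K B) = 1 := by
  rw [← Matrix.map_mul, flipM_mul_flipM, Matrix.map_one _ (map_zero _) (map_one _)]

theorem prod12_eq (X : Matrix (I M) (I N) B) : prod12 X =
    (flipM M).map (algebraMap K B) * prod21 X * (flipM N).map (algebraMap K B) := by
  rw [prod21_eq, Matrix.mul_assoc, Matrix.mul_assoc, Matrix.mul_assoc, map_flipM_mul_self,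
    Matrix.mul_one, ← Matrix.mul_assoc, map_flipM_mul_self, Matrix.one_mul]

/-- The relation `S X^1 X^2 = X^2 X^1 S` in terms of ordinary matrices. -/
theorem rtt_iff (X : Matrix (I M) (I N) B) :
    mulM (lscal (S M) (leg1 (L₁ := I M) X)) (leg2 (L₁ := I N) X) =
        rscal (mulM (leg2 (L₁ := I M) X) (leg1 (L₁ := I N) X)) (S N) ↔
      (R M).map (algebraMap K B) * prod12 X = prod12 X * (R N).map (algebraMap K B) := by
  rw [← unsign_injective.eq_iff, unsign_mulM, unsign_lscal, unsign_rscal, unsign_mulM,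
    unsign_leg2_mul_leg1, Matrix.mul_assoc, unsign_leg1_mul_leg2, prod21_eq, unsign_S, unsign_S,
    Matrix.map_mul, Matrix.map_mul]
  constructor
  · intro h
    have h' := congrArg (fun Z => (flipM M).map (algebraMap K B) * Z) h
    simp only [← Matrix.mul_assoc, map_flipM_mul_self, Matrix.one_mul] at h'
    simpa only [Matrix.mul_assoc, ← Matrix.mul_assoc (Matrix.map (flipM N) _),
      map_flipM_mul_self, Matrix.one_mul] using h'
  · intro h
    simp only [Matrix.mul_assoc,
      ← Matrix.mul_assoc (Matrix.map (flipM N) _) (Matrix.map (flipM N) _),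
      map_flipM_mul_self, Matrix.one_mul, h]

/-- The relation `X^1 X^2 S = S X^2 X^1` in terms of ordinary matrices. -/
theorem rtt_bar_iff (X : Matrix (I M) (I N) B) :
    rscal (mulM (leg1 (L₁ := I M) X) (leg2 (L₁ := I N) X)) (S N) =
        mulM (lscal (S M) (leg2 (L₁ := I M) X)) (leg1 (L₁ := I N) X) ↔
      (R M).map (algebraMap K B) * prod21 X = prod21 X * (R N).map (algebraMap K B) := by
  rw [← unsign_injective.eq_iff, unsign_mulM, unsign_lscal, unsign_rscal, unsign_mulM,
    unsign_leg1_mul_leg2, Matrix.mul_assoc, unsign_leg2_mul_leg1, prod12_eq, unsign_S, unsign_S,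
    Matrix.map_mul, Matrix.map_mul]
  constructor
  · intro h
    have h' := congrArg (fun Z => (flipM M).map (algebraMap K B) * Z) h
    simp only [← Matrix.mul_assoc, map_flipM_mul_self, Matrix.one_mul] at h'
    rw [← h']
    simp only [Matrix.mul_assoc, map_flipM_mul_self, Matrix.one_mul]
  · intro h
    simp only [Matrix.mul_assoc,
      ← Matrix.mul_assoc (Matrix.map (flipM N) _) (Matrix.map (flipM N) _),
      map_flipM_mul_self, Matrix.one_mul, h]

end Ordinary

/-! ### Reduction of the relations to positive rows -/

section RowSums
variable {B : Type} [Semiring B] [Algebra K B] {N : ℕ}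

theorem map_mul_apply {ι κ : Type} [Fintype ι] (P : Matrix ι ι K) (W : Matrix ι κ B) (u : ι)
    (v : κ) : (P.map (algebraMap K B) * W) u v = ∑ x, P u x • W x v := by
  simp only [Matrix.mul_apply, Matrix.map_apply, Algebra.smul_def]

theorem mul_map_apply {ι κ : Type} [Fintype κ] (P : Matrix κ κ K) (W : Matrix ι κ B) (u : ι)
    (v : κ) : (W * P.map (algebraMap K B)) u v = ∑ x, P x v • W u x := by
  simp only [Matrix.mul_apply, Matrix.map_apply, Algebra.smul_def, Algebra.commutes]

theorem sum_opp_fst {C : Type} [AddCommMonoid C] (f : I N × I N → C) :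
    ∑ x, f x = ∑ x : I N × I N, f (opp x.1, x.2) :=
  (Equiv.sum_comp ((oppEquiv N).prodCongr (Equiv.refl _)) f).symm

theorem sum_opp_snd {C : Type} [AddCommMonoid C] (f : I N × I N → C) :
    ∑ x, f x = ∑ x : I N × I N, f (x.1, opp x.2) :=
  (Equiv.sum_comp ((Equiv.refl _).prodCongr (oppEquiv N)) f).symm

end RowSums

section Rows
variable {B : Type} [Ring B] [Algebra K B] {M N : ℕ}

/-- The two sides of `R W = W R` change in the same way when the second row index is negated. -/
theorem row_opp_snd {W : Matrix (I M × I M) (I N × I N) B}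
    (h1 : ∀ i j a c, W (opp i, j) (opp a, c) = sg (pr i + pr a) • W (i, j) (a, c))
    (h2 : ∀ i j a c, W (i, opp j) (a, opp c) = sg (pr i + pr a + pr j + pr c) • W (i, j) (a, c))
    (i j : I M) (a c : I N) :
    ((R M).map (algebraMap K B) * W - W * (R N).map (algebraMap K B)) (i, opp j) (a, c) =
      sg (pr i + pr j + pr a + 1) •
        ((R M).map (algebraMap K B) * W - W * (R N).map (algebraMap K B)) (i, j) (opp a, c) := by
  simp only [Matrix.sub_apply, map_mul_apply, mul_map_apply, smul_sub, Finset.smul_sum, smul_smul]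
  congr 1
  · rw [sum_opp_fst]
    refine Finset.sum_congr rfl fun x _ => ?_
    have h := h1 x.1 x.2 (opp a) c
    rw [opp_opp] at h
    rw [h, R_opp_snd, opp_opp, smul_smul]
    congr 1
    simp only [pr_opp, sg_add, sg_one]
    grind [sg_mul_self]
  · rw [sum_opp_snd]
    refine Finset.sum_congr rfl fun x _ => ?_
    rw [h2, R_opp_snd, smul_smul]
    congr 1
    simp only [sg_add, sg_one]
    grind [sg_mul_self]

/-- The two sides of `R W = W R` change in the same way when the first row index is negated. -/
theorem row_opp_fst {W : Matrix (I M × I M) (I N × I N) B}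
    (h1 : ∀ i j a c, W (opp i, j) (opp a, c) = sg (pr i + pr a) • W (i, j) (a, c))
    (h2 : ∀ i j a c, W (i, opp j) (a, opp c) = sg (pr i + pr a + pr j + pr c) • W (i, j) (a, c))
    (i j : I M) (a c : I N) :
    ((R M).map (algebraMap K B) * W - W * (R N).map (algebraMap K B)) (opp i, j) (a, c) =
      sg (pr i + pr a + pr c + 1) •
        ((R M).map (algebraMap K B) * W - W * (R N).map (algebraMap K B)) (i, j) (a, opp c) := by
  -- The corrections by ξ in `R_opp_fst` contribute the same two terms to `R W` and, through the
  -- symmetries of `W`, to `W R`. They cancel in the difference.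
  have e1 : ∑ x, R M (opp i, j) x • W x (a, c) =
      sg (pr i + pr a + pr c + 1) • ∑ x, R M (i, j) x • W x (a, opp c) +
        ξ • W (opp i, j) (a, c) - (ξ * sg (pr j)) • W (i, opp j) (a, c) := by
    have h : ∀ x : I M × I M, R M (opp i, j) x • W x (a, c) =
        (sg (pr i + pr x.1 + pr x.2 + 1) * R M (i, j) (x.1, opp x.2)) • W x (a, c) +
        (if x = (opp i, j) then ξ • W x (a, c) else 0) -
        (if x = (i, opp j) then (ξ * sg (pr j)) • W x (a, c) else 0) := by
      rintro ⟨k, l⟩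
      rw [R_opp_fst, sub_smul, add_smul, ite_smul, ite_smul, zero_smul]
      simp only [Prod.mk.injEq]
    rw [Finset.sum_congr rfl fun x _ => h x, Finset.sum_sub_distrib, Finset.sum_add_distrib,
      Finset.sum_ite_eq', Finset.sum_ite_eq', if_pos (Finset.mem_univ _),
      if_pos (Finset.mem_univ _), sum_opp_snd, Finset.smul_sum]
    congr 2
    refine Finset.sum_congr rfl fun x _ => ?_
    have h := h2 x.1 x.2 a (opp c)
    rw [opp_opp] at h
    rw [h, opp_opp, smul_smul, smul_smul]
    congr 1
    simp only [pr_opp, sg_add, sg_one]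
    grind [sg_mul_self]
  have e2 : ∑ x, R N x (a, c) • W (opp i, j) x =
      sg (pr i + pr a + pr c + 1) • ∑ x, R N x (a, opp c) • W (i, j) x +
        ξ • W (opp i, j) (a, c) - (ξ * sg (pr j)) • W (i, opp j) (a, c) := by
    have h : ∀ x : I N × I N, R N (opp x.1, x.2) (a, c) • W (opp i, j) (opp x.1, x.2) =
        (sg (pr i + pr a + pr c + 1) * R N x (a, opp c)) • W (i, j) x +
        (if x = (opp a, c) then (ξ * sg (pr i + pr a + 1)) • W (i, j) x else 0) -
        (if x = (a, opp c) then (ξ * sg (pr i + pr a + pr c + 1)) • W (i, j) x else 0) := by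
      rintro ⟨k, l⟩
      have c1 : a = opp k ∧ c = l ↔ k = opp a ∧ l = c :=
        and_congr ((eq_comm.trans (opp_eq_iff _ _))) eq_comm
      have c2 : a = k ∧ c = opp l ↔ k = a ∧ l = opp c :=
        and_congr eq_comm ((eq_comm.trans (opp_eq_iff _ _)))
      rw [R_opp_fst, h1, smul_smul]
      simp only [c1, c2, Prod.mk.injEq]
      by_cases d1 : k = opp a ∧ l = c
      · have d2 : ¬ (k = a ∧ l = opp c) := fun d => opp_ne_self a (d1.1.symm.trans d.1)
        rw [if_pos d1, if_neg d2, if_pos d1, if_neg d2, sub_zero, sub_zero, ← add_smul]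
        obtain ⟨rfl, rfl⟩ := d1
        congr 1
        simp only [pr_opp, sg_add, sg_one]
        grind [sg_mul_self]
      · by_cases d2 : k = a ∧ l = opp c
        · rw [if_neg d1, if_pos d2, if_neg d1, if_pos d2, add_zero, add_zero, ← sub_smul]
          obtain ⟨rfl, rfl⟩ := d2
          congr 1
          simp only [pr_opp, sg_add, sg_one]
          grind [sg_mul_self]
        · rw [if_neg d1, if_neg d2, if_neg d1, if_neg d2, add_zero, add_zero, sub_zero, sub_zero]
          congr 1
          simp only [sg_add, sg_one]
          grind [sg_mul_self]
    rw [sum_opp_fst, Finset.sum_congr rfl fun x _ => h x, Finset.sum_sub_distrib,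
      Finset.sum_add_distrib, Finset.sum_ite_eq', Finset.sum_ite_eq', if_pos (Finset.mem_univ _),
      if_pos (Finset.mem_univ _), Finset.smul_sum]
    have k1 := h1 i j (opp a) c
    have k2 := h2 i j a (opp c)
    rw [opp_opp] at k1 k2
    rw [k1, k2, smul_smul, smul_smul]
    simp only [smul_smul]
    refine congrArg₂ (· - ·) (congrArg₂ (· + ·) rfl ?_) ?_
    · rw [pr_opp, add_assoc]
    · congr 1
      simp only [pr_opp, sg_add, sg_one]
      grind [sg_mul_self]
  simp only [Matrix.sub_apply, map_mul_apply, mul_map_apply, e1, e2, smul_sub]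
  abel

/-- An entry of `R W - W R` in a row with a negative index is, up to sign, an entry in the row with
that index negated. The second index is made positive first, then the first. -/
theorem eq_of_pos_rows {W : Matrix (I M × I M) (I N × I N) B}
    (h1 : ∀ i j a c, W (opp i, j) (opp a, c) = sg (pr i + pr a) • W (i, j) (a, c))
    (h2 : ∀ i j a c, W (i, opp j) (a, opp c) = sg (pr i + pr a + pr j + pr c) • W (i, j) (a, c))
    (h : ∀ i j : I M, 0 < i.1 → 0 < j.1 → ∀ v,
      ((R M).map (algebraMap K B) * W) (i, j) v = (W * (R N).map (algebraMap K B)) (i, j) v) :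
    (R M).map (algebraMap K B) * W = W * (R N).map (algebraMap K B) := by
  rw [← sub_eq_zero]
  have hneg : ∀ i : I M, ¬ 0 < i.1 → 0 < (opp i).1 := fun i hi => by
    have := val_ne_zero i
    rw [opp_val]
    omega
  have p1 : ∀ i j : I M, 0 < i.1 → ∀ v,
      ((R M).map (algebraMap K B) * W - W * (R N).map (algebraMap K B)) (i, j) v = 0 := by
    intro i j hi v
    by_cases hj : 0 < j.1
    · rw [Matrix.sub_apply, h i j hi hj, sub_self]
    · have := row_opp_snd h1 h2 i (opp j) v.1 v.2
      rw [opp_opp, Matrix.sub_apply _ _ (i, opp j), h i _ hi (hneg j hj), sub_self,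
        smul_zero] at this
      exact this
  ext ⟨i, j⟩ v
  by_cases hi : 0 < i.1
  · exact p1 i j hi v
  · have := row_opp_fst h1 h2 (opp i) j v.1 v.2
    rw [opp_opp, p1 _ _ (hneg i hi), smul_zero] at this
    exact this

theorem prod12_opp_fst {X : Matrix (I M) (I N) B} (hX : ∀ i a, X (opp i) (opp a) = X i a)
    (i j : I M) (a c : I N) :
    prod12 X (opp i, j) (opp a, c) = sg (pr i + pr a) • prod12 X (i, j) (a, c) := by
  simp only [prod12, hX, smul_smul, ← sg_add, pr_opp]
  congr 2
  generalize pr i = i, pr j = j, pr a = a, pr c = c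
  revert i j a c
  decide

theorem prod12_opp_snd {X : Matrix (I M) (I N) B} (hX : ∀ i a, X (opp i) (opp a) = X i a)
    (i j : I M) (a c : I N) :
    prod12 X (i, opp j) (a, opp c) = sg (pr i + pr a + pr j + pr c) • prod12 X (i, j) (a, c) := by
  simp only [prod12, hX, smul_smul, ← sg_add, pr_opp]
  congr 2
  generalize pr i = i, pr j = j, pr a = a, pr c = c
  revert i j a c
  decide

end Rows

/-! ### Universal properties of the coordinate superalgebras -/

section Map
variable {I₁ I₂ J₁ J₂ L₁ L₂ : Type} [HasParity I₁] [HasParity I₂] [HasParity J₁] [HasParity J₂]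
  [HasParity L₁] [HasParity L₂] [Fintype J₁] [Fintype J₂]
  {B C : Type} [Semiring B] [Algebra K B] [Semiring C] [Algebra K C]

theorem map_mulM (f : B →ₐ[K] C) (X : Matrix (I₁ × I₂) (J₁ × J₂) B)
    (Y : Matrix (J₁ × J₂) (L₁ × L₂) B) : (mulM X Y).map f = mulM (X.map f) (Y.map f) := by
  ext u v
  simp [mulM, superMul, map_sum, map_smul]

theorem map_lscal (f : B →ₐ[K] C) (X : Matrix (I₁ × I₂) (J₁ × J₂) K)
    (Y : Matrix (J₁ × J₂) (L₁ × L₂) B) : (lscal X Y).map f = lscal X (Y.map f) := by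
  ext u v
  simp [lscal, superMul, map_sum, map_smul]

theorem map_rscal (f : B →ₐ[K] C) (X : Matrix (I₁ × I₂) (J₁ × J₂) B)
    (Y : Matrix (J₁ × J₂) (L₁ × L₂) K) : (rscal X Y).map f = rscal (X.map f) Y := by
  ext u v
  simp [rscal, superMul, map_sum, map_smul]

end Map

section MapLeg
variable {I₁ J₁ L₁ : Type} [DecidableEq L₁]
  {B C : Type} [Semiring B] [Algebra K B] [Semiring C] [Algebra K C]

theorem map_leg1 (f : B →ₐ[K] C) (X : Matrix I₁ J₁ B) :
    (leg1 (L₁ := L₁) X).map f = leg1 (X.map f) := by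
  ext u v
  simp [leg1, apply_ite f]

theorem map_leg2 (f : B →ₐ[K] C) (X : Matrix I₁ J₁ B) :
    (leg2 (L₁ := L₁) X).map f = leg2 (X.map f) := by
  ext u v
  simp [leg2, apply_ite f]

end MapLeg

theorem T_opp (r n : ℕ) (i : I r) (a : I n) : T r n (opp i) (opp a) = T r n i a :=
  (RingQuot.mkAlgHom_rel K (ARel.opp i a)).symm

theorem T_rtt (r n : ℕ) : (R r).map (algebraMap K (A r n)) * prod12 (T r n) =
    prod12 (T r n) * (R n).map (algebraMap K (A r n)) := by
  rw [← rtt_iff]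
  have h : (freeT r n).map (RingQuot.mkAlgHom K (ARel r n)) = T r n := rfl
  ext u v
  have := RingQuot.mkAlgHom_rel K (ARel.rtt u v)
  rw [← h]
  simp only [← map_leg1, ← map_leg2, ← map_lscal, ← map_mulM, ← map_rscal]
  exact this

theorem Tbar_opp (s n : ℕ) (b : I n) (α : I s) : Tbar s n (opp b) (opp α) = Tbar s n b α := by
  have h : tbar s n α b = sg (pr α + pr b) • tbar s n (opp α) (opp b) := by
    have h := RingQuot.mkAlgHom_rel K (AbarRel.opp α b)
    rw [map_smul, neg_one_pow_eq_sg] at h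
    simpa [tbar] using h
  simp only [Tbar, h, neg_one_pow_eq_sg, smul_smul, ← sg_add, Nat.cast_mul, Nat.cast_add, cast_par,
    pr_opp]
  congr 2
  generalize pr b = b, pr α = a
  revert a b
  decide

theorem map_freeTbar (s n : ℕ) {B : Type} [Semiring B] [Algebra K B]
    (f : FreeAlgebra K (I s × I n) →ₐ[K] B) : (freeTbar s n).map f =
      fun b α => sg (pr b * (pr α + pr b)) • f (FreeAlgebra.ι K (α, b)) := by
  ext b α
  simp [freeTbar, neg_one_pow_eq_sg]

theorem Tbar_rtt (s n : ℕ) : (R n).map (algebraMap K (Abar s n)) * prod21 (Tbar s n) =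
    prod21 (Tbar s n) * (R s).map (algebraMap K (Abar s n)) := by
  rw [← rtt_bar_iff]
  have h : (freeTbar s n).map (RingQuot.mkAlgHom K (AbarRel s n)) = Tbar s n := by
    rw [map_freeTbar]
    ext b α
    simp [Tbar, tbar, neg_one_pow_eq_sg]
  ext u v
  have := RingQuot.mkAlgHom_rel K (AbarRel.rtt u v)
  rw [← h]
  simp only [← map_leg1, ← map_leg2, ← map_lscal, ← map_mulM, ← map_rscal]
  exact this

theorem exists_lift_A {r n : ℕ} {B : Type} [Semiring B] [Algebra K B] (X : Matrix (I r) (I n) B)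
    (hX : ∀ i a, X (opp i) (opp a) = X i a)
    (hR : (R r).map (algebraMap K B) * prod12 X = prod12 X * (R n).map (algebraMap K B)) :
    ∃ f : A r n →ₐ[K] B, ∀ i a, f (T r n i a) = X i a := by
  let g : FreeAlgebra K (I r × I n) →ₐ[K] B := FreeAlgebra.lift K fun p => X p.1 p.2
  have hg : (freeT r n).map g = X := by
    ext i a
    simp [freeT, g]
  have h : ∀ ⦃x y⦄, ARel r n x y → g x = g y := by
    intro x y hxy
    cases hxy with
    | opp i a => simp [freeT, g, hX]
    | rtt u v =>
      have := congrFun (congrFun ((rtt_iff X).2 hR) u) v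
      rw [← hg] at this
      simp only [← map_leg1, ← map_leg2, ← map_lscal, ← map_mulM, ← map_rscal] at this
      exact this
  refine ⟨RingQuot.liftAlgHom K ⟨g, h⟩, fun i a => ?_⟩
  rw [T, RingQuot.liftAlgHom_mkAlgHom_apply]
  simp [g]

theorem exists_lift_Abar {s n : ℕ} {B : Type} [Semiring B] [Algebra K B] (X : Matrix (I n) (I s) B)
    (hX : ∀ b α, X (opp b) (opp α) = X b α)
    (hR : (R n).map (algebraMap K B) * prod21 X = prod21 X * (R s).map (algebraMap K B)) :
    ∃ f : Abar s n →ₐ[K] B, ∀ b α, f (Tbar s n b α) = X b α := by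
  -- The generator is recovered from the entry of `T̄` by the same sign, which is its own inverse.
  let g : FreeAlgebra K (I s × I n) →ₐ[K] B :=
    FreeAlgebra.lift K fun p => sg (pr p.2 * (pr p.1 + pr p.2)) • X p.2 p.1
  have hg : (freeTbar s n).map g = X := by
    rw [map_freeTbar]
    ext b α
    simp [g, smul_smul, sg_mul_self]
  have h : ∀ ⦃x y⦄, AbarRel s n x y → g x = g y := by
    intro x y hxy
    cases hxy with
    | opp α b =>
      simp only [map_smul, FreeAlgebra.lift_ι_apply, g, hX, pr_opp, neg_one_pow_eq_sg, Nat.cast_add,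
        cast_par, smul_smul, ← sg_add]
      congr 2
      generalize pr b = b, pr α = a
      revert a b
      decide
    | rtt u v =>
      have := congrFun (congrFun ((rtt_bar_iff X).2 hR) u) v
      rw [← hg] at this
      simp only [← map_leg1, ← map_leg2, ← map_lscal, ← map_mulM, ← map_rscal] at this
      exact this
  refine ⟨RingQuot.liftAlgHom K ⟨g, h⟩, fun b α => ?_⟩
  rw [Tbar, map_smul, tbar, RingQuot.liftAlgHom_mkAlgHom_apply]
  simp [g, neg_one_pow_eq_sg, smul_smul, sg_mul_self]

theorem adjoin_T (r n : ℕ) :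
    Algebra.adjoin K {x | ∃ (i : I r) (a : I n), 0 < i.1 ∧ T r n i a = x} = ⊤ := by
  rw [eq_top_iff]
  rintro x -
  obtain ⟨x, rfl⟩ := RingQuot.mkAlgHom_surjective K (ARel r n) x
  induction x using FreeAlgebra.induction with
  | grade0 c =>
    rw [AlgHom.commutes]
    exact Subalgebra.algebraMap_mem _ _
  | grade1 p =>
    apply Algebra.subset_adjoin
    by_cases h : 0 < p.1.1
    · exact ⟨p.1, p.2, h, rfl⟩
    · have := val_ne_zero p.1
      exact ⟨opp p.1, opp p.2, by rw [opp_val]; omega, T_opp r n p.1 p.2⟩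
  | mul x y hx hy => rw [map_mul]; exact mul_mem hx hy
  | add x y hx hy => rw [map_add]; exact add_mem hx hy

theorem tbar_eq {s n : ℕ} (α : I s) (b : I n) :
    tbar s n α b = sg (pr b * (pr α + pr b)) • Tbar s n b α := by
  simp [Tbar, neg_one_pow_eq_sg, smul_smul, sg_mul_self]

theorem adjoin_Tbar (s n : ℕ) :
    Algebra.adjoin K {x | ∃ y : I n × I s, Tbar s n y.1 y.2 = x} = ⊤ := by
  rw [eq_top_iff]
  rintro x -
  obtain ⟨x, rfl⟩ := RingQuot.mkAlgHom_surjective K (AbarRel s n) x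
  induction x using FreeAlgebra.induction with
  | grade0 c =>
    rw [AlgHom.commutes]
    exact Subalgebra.algebraMap_mem _ _
  | grade1 p =>
    change tbar s n p.1 p.2 ∈ _
    rw [tbar_eq]
    have h : Tbar s n p.2 p.1 ∈ {x | ∃ y : I n × I s, Tbar s n y.1 y.2 = x} := ⟨(p.2, p.1), rfl⟩
    exact Subalgebra.smul_mem _ (Algebra.subset_adjoin h) _
  | mul x y hx hy => rw [map_mul]; exact mul_mem hx hy
  | add x y hx hy => rw [map_add]; exact add_mem hx hy

/-! ### The action of the exchange relation on `A_{r,n}` -/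

/-- The coefficients of the exchange relation between `T̄` and the positive rows of `T`. -/
def exchangePos (r s n : ℕ) (i : I r) (a : I n) : Matrix (I n × I s) (I n × I s) (A r n) :=
  fun y z => if y.2 = z.2 then
    -- The sign is what the twists on the two sides of property 3 leave over; see
    -- `unsign_tmulM_Tplus_Sinv_Tbar`.
    ∑ x : I n, (sg ((pr y.2 + 1) * pr x + pr a) * Rinv n (y.1, x) (a, z.1)) • T r n i x else 0

/-- The coefficients of the exchange relation between `T̄` and `T`. -/
def exchange (r s n : ℕ) : Matrix (I r) (I n) (Matrix (I n × I s) (I n × I s) (A r n)) :=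
  fun i a => if 0 < i.1 then exchangePos r s n i a else exchangePos r s n (opp i) (opp a)

theorem exchange_opp {r s n : ℕ} (i : I r) (a : I n) :
    exchange r s n (opp i) (opp a) = exchange r s n i a := by
  have := val_ne_zero i
  simp only [exchange, opp_val, opp_opp]
  split_ifs <;> first | rfl | omega

theorem leg12_mul_leg23_apply {n : ℕ} (P Q : Matrix (I n × I n) (I n × I n) K)
    (b x y a c d : I n) :
    (leg12 P * leg23 Q) (b, x, y) (a, c, d) = ∑ z, P (b, x) (a, z) * Q (z, y) (c, d) := by
  simp only [Matrix.mul_apply, leg12, leg23, Fintype.sum_prod_type, ite_mul, mul_ite, zero_mul,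
    mul_zero]
  simp

theorem mul_leg12_apply {n : ℕ} (G : Matrix (I n × I n × I n) (I n × I n × I n) K)
    (P : Matrix (I n × I n) (I n × I n) K) (v : I n × I n × I n) (a c d : I n) :
    (G * leg12 P) v (a, c, d) = ∑ u : I n × I n, G v (u.1, u.2, d) * P u (a, c) := by
  simp only [Matrix.mul_apply, leg12, Fintype.sum_prod_type, mul_ite, mul_zero]
  simp

theorem leg23_mul_apply {n : ℕ} (G : Matrix (I n × I n × I n) (I n × I n × I n) K)
    (P : Matrix (I n × I n) (I n × I n) K) (b : I n) (w : I n × I n) (v : I n × I n × I n) :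
    (leg23 P * G) (b, w) v = ∑ x, P w x * G (b, x) v := by
  simp only [Matrix.mul_apply, leg23, Fintype.sum_prod_type, ite_mul, zero_mul]
  simp

theorem sum_mul_sum_smul {ι κ : Type} [Fintype ι] [Fintype κ] {B : Type} [Semiring B] [Algebra K B]
    (f : ι → κ → K) (g : κ → ι → K) (t t' : ι → B) :
    ∑ z, (∑ x, f x z • t x) * (∑ y, g z y • t' y) =
      ∑ x : ι × ι, (∑ z, f x.1 z * g z x.2) • (t x.1 * t' x.2) := by
  simp only [Finset.sum_mul_sum, smul_mul_smul_comm, Finset.sum_smul, Fintype.sum_prod_type]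
  rw [Finset.sum_comm]
  exact Finset.sum_congr rfl fun x _ => Finset.sum_comm

/-- Moving T̄ past two rows of T₊ gives two inverse crossings. The remaining sign sees `x` only
through its total parity, so the even matrix R does not disturb it. -/
theorem prod12_exchange {r s n : ℕ} (i j : I r) (hi : 0 < i.1) (hj : 0 < j.1) (a c : I n)
    (y z : I n × I s) : prod12 (exchange r s n) (i, j) (a, c) y z =
      if y.2 = z.2 then ∑ x : I n × I n, (sg (pr y.2 * (pr x.1 + pr x.2)) *
        (leg12 (Rinv n) * leg23 (Rinv n)) (y.1, x) (a, c, z.1)) • prod12 (T r n) (i, j) x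
      else 0 := by
  obtain ⟨b, α⟩ := y
  obtain ⟨d, β⟩ := z
  have e : (exchangePos r s n i a * exchangePos r s n j c) (b, α) (d, β) =
      if α = β then ∑ x : I n × I n, (sg ((pr α + 1) * (pr x.1 + pr x.2) + pr a + pr c) *
        (leg12 (Rinv n) * leg23 (Rinv n)) (b, x) (a, c, d)) • (T r n i x.1 * T r n j x.2)
      else 0 := by
    rw [Matrix.mul_apply, Fintype.sum_prod_type_right]
    simp only [exchangePos, ite_mul, mul_ite, zero_mul, mul_zero]
    by_cases h : α = β
    · subst h
      rw [Finset.sum_eq_single α]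
      rotate_left
      · intro γ _ hγ
        simp [hγ]
      · simp
      simp only [if_true]
      refine (sum_mul_sum_smul
        (fun x z => sg ((pr α + 1) * pr x + pr a) * Rinv n (b, x) (a, z))
        (fun z y => sg ((pr α + 1) * pr y + pr c) * Rinv n (z, y) (c, d))
        (T r n i) (T r n j)).trans ?_
      refine Finset.sum_congr rfl fun x _ => ?_
      congr 1
      obtain ⟨x, y⟩ := x
      rw [leg12_mul_leg23_apply, Finset.mul_sum]
      refine Finset.sum_congr rfl fun z _ => ?_
      simp only [sg_add, mul_add]
      ring
    · rw [if_neg h]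
      refine Finset.sum_eq_zero fun x _ => Finset.sum_eq_zero fun y _ => ?_
      split_ifs with h1 h2
      · exact (h (h2.trans h1)).elim
      · rfl
      · rfl
  simp only [prod12, exchange, hi, hj, if_true, Matrix.smul_apply]
  rw [e, smul_ite, smul_zero]
  congr 1
  rw [Finset.smul_sum]
  refine Finset.sum_congr rfl fun x _ => ?_
  simp only [smul_smul, pr_of_pos hi, pr_of_pos hj]
  congr 1
  rw [← mul_assoc, ← sg_add, mul_right_comm (sg (pr α * _)), ← sg_add]
  congr 2
  generalize pr a = a, pr c = c, pr α = d, pr x.1 = x, pr x.2 = y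
  revert a c d x y
  decide

theorem exchange_rtt (r s n : ℕ) :
    (R r).map (algebraMap K (Matrix (I n × I s) (I n × I s) (A r n))) * prod12 (exchange r s n) =
      prod12 (exchange r s n) *
        (R n).map (algebraMap K (Matrix (I n × I s) (I n × I s) (A r n))) := by
  refine eq_of_pos_rows (prod12_opp_fst exchange_opp) (prod12_opp_snd exchange_opp) ?_
  rintro i j hi hj ⟨a, c⟩
  ext y z
  rw [map_mul_apply, mul_map_apply, Matrix.sum_apply, Matrix.sum_apply]
  simp only [Matrix.smul_apply]
  -- By `R_pos`, only positive rows `u` occur, where `prod12_exchange` applies.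
  have e1 : ∀ u : I r × I r, R r (i, j) u • prod12 (exchange r s n) u (a, c) y z =
      if y.2 = z.2 then ∑ x : I n × I n, (sg (pr y.2 * (pr x.1 + pr x.2)) *
        (leg12 (Rinv n) * leg23 (Rinv n)) (y.1, x) (a, c, z.1)) •
          R r (i, j) u • prod12 (T r n) u x else 0 := by
    intro u
    by_cases hu : R r (i, j) u = 0
    · simp [hu]
    · obtain ⟨h1, h2⟩ := R_pos hi hj hu
      rw [prod12_exchange u.1 u.2 h1 h2, smul_ite, smul_zero, Finset.smul_sum]
      simp only [smul_comm (R r (i, j) u)]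
  have e2 : ∀ u : I n × I n, R n u (a, c) • prod12 (exchange r s n) (i, j) u y z =
      if y.2 = z.2 then ∑ x : I n × I n, (sg (pr y.2 * (pr x.1 + pr x.2)) *
        ((leg12 (Rinv n) * leg23 (Rinv n)) (y.1, x) (u.1, u.2, z.1) * R n u (a, c))) •
          prod12 (T r n) (i, j) x else 0 := by
    intro u
    rw [prod12_exchange i j hi hj, smul_ite, smul_zero, Finset.smul_sum]
    congr 1
    refine Finset.sum_congr rfl fun x _ => ?_
    rw [smul_smul]
    congr 1
    ring
  rw [Finset.sum_congr rfl fun u _ => e1 u, Finset.sum_congr rfl fun u _ => e2 u]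
  by_cases h : y.2 = z.2
  swap
  · simp [h]
  simp only [h, if_true]
  conv_lhs => rw [Finset.sum_comm]
  conv_rhs => rw [Finset.sum_comm]
  -- The relation in `A r n` moves R from the row indices to the summation indices.
  have e3 : ∀ x, ∑ u, R r (i, j) u • prod12 (T r n) u x =
      ∑ w, R n w x • prod12 (T r n) (i, j) w := fun x => by
    have := congrFun (congrFun (T_rtt r n) (i, j)) x
    rwa [map_mul_apply, mul_map_apply] at this
  simp only [← Finset.smul_sum, ← Finset.sum_smul, e3]
  simp only [Finset.smul_sum, smul_smul]
  rw [Finset.sum_comm]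
  refine Finset.sum_congr rfl fun w _ => ?_
  rw [← Finset.sum_smul]
  congr 1
  rw [← Finset.mul_sum]
  -- The braid relation moves R across the two inverse crossings, onto the column indices.
  have e4 := congrFun (congrFun (Rinv_Rinv_R n) (y.1, w)) (a, c, z.1)
  rw [mul_leg12_apply, leg23_mul_apply] at e4
  rw [e4, Finset.mul_sum]
  refine Finset.sum_congr rfl fun x _ => ?_
  by_cases hx : pr w.1 + pr w.2 = pr x.1 + pr x.2
  · rw [hx]
    ring
  · rw [R_even hx]
    ring

/-! ### Twisted tensor products -/

section Twisted
variable {B C : Type} [Semiring B] [Algebra K B] [Semiring C] [Algebra K C]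

variable (B C) in
/-- Left multiplication by `b` on the first factor of `B ⊗ C`. -/
def lact (b : B) : B ⊗[K] C →ₗ[K] B ⊗[K] C := (LinearMap.mulLeft K b).rTensor C

variable (B C) in
/-- Right multiplication by `c` on the second factor of `B ⊗ C`. -/
def ract (c : C) : B ⊗[K] C →ₗ[K] B ⊗[K] C := (LinearMap.mulRight K c).lTensor B

@[simp] theorem lact_tmul (b b' : B) (c : C) : lact B C b (b' ⊗ₜ c) = (b * b') ⊗ₜ c := rfl

@[simp] theorem ract_tmul (b : B) (c c' : C) : ract B C c (b ⊗ₜ c') = b ⊗ₜ (c' * c) := rfl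

theorem lact_mul (b b' : B) (z : B ⊗[K] C) : lact B C (b * b') z = lact B C b (lact B C b' z) := by
  induction z with
  | zero => simp
  | add z w hz hw => simp only [map_add, hz, hw]
  | tmul x y => simp [mul_assoc]

theorem ract_mul (c c' : C) (z : B ⊗[K] C) : ract B C (c * c') z = ract B C c' (ract B C c z) := by
  induction z with
  | zero => simp
  | add z w hz hw => simp only [map_add, hz, hw]
  | tmul x y => simp [mul_assoc]

theorem lact_ract (b : B) (c : C) (z : B ⊗[K] C) :
    lact B C b (ract B C c z) = ract B C c (lact B C b z) := by
  induction z with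
  | zero => simp
  | add z w hz hw => simp only [map_add, hz, hw]
  | tmul x y => simp

theorem lact_one (z : B ⊗[K] C) : lact B C 1 z = z := by
  simp [lact]

theorem ract_one (z : B ⊗[K] C) : ract B C 1 z = z := by
  simp [ract]

variable (Υ : C ⊗[K] B →ₗ[K] B ⊗[K] C)

theorem braidedMul_tmul (b b' : B) (c c' : C) :
    braidedMul Υ ((b ⊗ₜ c) ⊗ₜ (b' ⊗ₜ c')) = lact B C b (ract B C c' (Υ (c ⊗ₜ b'))) := by
  simp only [braidedMul, LinearMap.comp_apply, LinearEquiv.coe_coe, TensorProduct.assoc_tmul,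
    LinearMap.lTensor_tmul, TensorProduct.assoc_symm_tmul, LinearMap.rTensor_tmul]
  induction Υ (c ⊗ₜ b') with
  | zero => simp
  | add z w hz hw => simp only [TensorProduct.add_tmul, TensorProduct.tmul_add, map_add, hz, hw]
  | tmul x y => simp

theorem braidedMul_lact (b : B) (z w : B ⊗[K] C) :
    braidedMul Υ (lact B C b z ⊗ₜ w) = lact B C b (braidedMul Υ (z ⊗ₜ w)) := by
  induction z with
  | zero => simp
  | add z z' hz hz' => simp only [TensorProduct.add_tmul, map_add, hz, hz']
  | tmul x y =>
    induction w with
    | zero => simp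
    | add w w' hw hw' => simp only [TensorProduct.tmul_add, map_add, hw, hw']
    | tmul x' y' => rw [lact_tmul, braidedMul_tmul, braidedMul_tmul, lact_mul]

theorem braidedMul_ract (c : C) (z w : B ⊗[K] C) :
    braidedMul Υ (z ⊗ₜ ract B C c w) = ract B C c (braidedMul Υ (z ⊗ₜ w)) := by
  induction z with
  | zero => simp
  | add z z' hz hz' => simp only [TensorProduct.add_tmul, map_add, hz, hz']
  | tmul x y =>
    induction w with
    | zero => simp
    | add w w' hw hw' => simp only [TensorProduct.tmul_add, map_add, hw, hw']
    | tmul x' y' => rw [ract_tmul, braidedMul_tmul, braidedMul_tmul, ract_mul, lact_ract]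

/-- In the braided product the diagram reads Υ(c ⊗ ff') = Υ(c ⊗ f) · (f' ⊗ 1). -/
theorem diagram1_of (h : ∀ (c : C) (f f' : B),
    Υ (c ⊗ₜ (f * f')) = braidedMul Υ (Υ (c ⊗ₜ f) ⊗ₜ (f' ⊗ₜ 1))) : Diagram1 Υ := by
  apply TensorProduct.ext'
  intro c w
  induction w with
  | zero => simp
  | add w w' hw hw' => simp only [TensorProduct.tmul_add, map_add, hw, hw']
  | tmul f f' =>
    simp only [LinearMap.comp_apply, LinearMap.lTensor_tmul, LinearEquiv.coe_coe,
      TensorProduct.assoc_symm_tmul, LinearMap.rTensor_tmul, LinearMap.mul'_apply, h]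
    induction Υ (c ⊗ₜ f) with
    | zero => simp
    | add z w hz hw => simp only [TensorProduct.add_tmul, map_add, hz, hw]
    | tmul x y =>
      rw [braidedMul_tmul, ract_one]
      simp only [TensorProduct.assoc_tmul, LinearMap.lTensor_tmul]
      induction Υ (y ⊗ₜ f') with
      | zero => simp
      | add z w hz hw => simp only [TensorProduct.tmul_add, map_add, hz, hw]
      | tmul x' y' => simp

theorem diagram2_of (h : ∀ (c c' : C) (f : B),
    Υ ((c * c') ⊗ₜ f) = braidedMul Υ ((1 ⊗ₜ c) ⊗ₜ Υ (c' ⊗ₜ f))) : Diagram2 Υ := by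
  apply TensorProduct.ext'
  intro w f
  induction w with
  | zero => simp
  | add w w' hw hw' => simp only [TensorProduct.add_tmul, map_add, hw, hw']
  | tmul c c' =>
    simp only [LinearMap.comp_apply, LinearMap.lTensor_tmul, LinearEquiv.coe_coe,
      TensorProduct.assoc_tmul, LinearMap.rTensor_tmul, LinearMap.mul'_apply, h]
    induction Υ (c' ⊗ₜ f) with
    | zero => simp
    | add z w hz hw => simp only [TensorProduct.tmul_add, map_add, hz, hw]
    | tmul x y =>
      rw [braidedMul_tmul, lact_one]
      simp only [TensorProduct.assoc_symm_tmul, LinearMap.rTensor_tmul]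
      induction Υ (c ⊗ₜ x) with
      | zero => simp
      | add z w hz hw => simp only [TensorProduct.add_tmul, map_add, hz, hw]
      | tmul x' y' => simp

/-- For pure tensors, both bracketings equal b · (Υ(c ⊗ b') · Υ(c' ⊗ b'')) · c''. The outer factors
come out because the product is linear over left multiplication by `B` and right multiplication by
`C`; the two hypotheses give `e1` and `e2`. -/
theorem braidedMul_assoc
    (h1 : ∀ (c : C) (f f' : B), Υ (c ⊗ₜ (f * f')) = braidedMul Υ (Υ (c ⊗ₜ f) ⊗ₜ (f' ⊗ₜ 1)))
    (h2 : ∀ (c c' : C) (f : B), Υ ((c * c') ⊗ₜ f) = braidedMul Υ ((1 ⊗ₜ c) ⊗ₜ Υ (c' ⊗ₜ f)))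
    (x y z : B ⊗[K] C) :
    braidedMul Υ (braidedMul Υ (x ⊗ₜ y) ⊗ₜ z) = braidedMul Υ (x ⊗ₜ braidedMul Υ (y ⊗ₜ z)) := by
  have e1 : ∀ (w : B ⊗[K] C) (c' c'' : C) (b'' : B),
      braidedMul Υ (ract B C c' w ⊗ₜ (b'' ⊗ₜ c'')) =
        ract B C c'' (braidedMul Υ (w ⊗ₜ Υ (c' ⊗ₜ b''))) := by
    intro w c' c'' b''
    induction w with
    | zero => simp
    | add w w' hw hw' => simp only [TensorProduct.add_tmul, map_add, hw, hw']
    | tmul b c =>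
      rw [ract_tmul, braidedMul_tmul, h2, lact_ract, ← braidedMul_lact, lact_tmul, mul_one]
  have e2 : ∀ (w : B ⊗[K] C) (c : C) (b b' : B),
      braidedMul Υ ((b ⊗ₜ c) ⊗ₜ lact B C b' w) =
        lact B C b (braidedMul Υ (Υ (c ⊗ₜ b') ⊗ₜ w)) := by
    intro w c b b'
    induction w with
    | zero => simp
    | add w w' hw hw' => simp only [TensorProduct.tmul_add, map_add, hw, hw']
    | tmul b'' c'' =>
      rw [lact_tmul, braidedMul_tmul, h1, ← braidedMul_ract, ract_tmul, one_mul]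
  induction x with
  | zero => simp
  | add x x' hx hx' => simp only [TensorProduct.add_tmul, map_add, hx, hx']
  | tmul b c =>
    induction y with
    | zero => simp
    | add y y' hy hy' =>
      simp only [TensorProduct.add_tmul, TensorProduct.tmul_add, map_add, hy, hy']
    | tmul b' c' =>
      induction z with
      | zero => simp
      | add z z' hz hz' => simp only [TensorProduct.tmul_add, map_add, hz, hz']
      | tmul b'' c'' =>
        rw [braidedMul_tmul, braidedMul_lact, e1, braidedMul_tmul, e2, braidedMul_ract]

theorem one_braidedMul (h : ∀ f : B, Υ (1 ⊗ₜ f) = f ⊗ₜ 1) (x : B ⊗[K] C) :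
    braidedMul Υ ((1 ⊗ₜ 1) ⊗ₜ x) = x := by
  induction x with
  | zero => simp
  | add x x' hx hx' => simp only [TensorProduct.tmul_add, map_add, hx, hx']
  | tmul b c => rw [braidedMul_tmul, h, lact_one, ract_tmul, one_mul]

theorem braidedMul_one (h : ∀ g : C, Υ (g ⊗ₜ 1) = 1 ⊗ₜ g) (x : B ⊗[K] C) :
    braidedMul Υ (x ⊗ₜ (1 ⊗ₜ 1)) = x := by
  induction x with
  | zero => simp
  | add x x' hx hx' => simp only [TensorProduct.add_tmul, map_add, hx, hx']
  | tmul b c => rw [braidedMul_tmul, h, ract_one, lact_tmul, mul_one]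

/-! ### Twisting maps from exchange matrices -/

/-- The twisting map `c ⊗ f ↦ ρ(c)(f ⊗ 1)` of an action `ρ` of `C` on `B ⊗ C`. -/
def twisting (ρ : C →ₐ[K] Module.End K (B ⊗[K] C)) : C ⊗[K] B →ₗ[K] B ⊗[K] C :=
  TensorProduct.lift
    (LinearMap.lcomp K (B ⊗[K] C) ((TensorProduct.mk K B C).flip 1) ∘ₗ ρ.toLinearMap)

@[simp] theorem twisting_tmul (ρ : C →ₐ[K] Module.End K (B ⊗[K] C)) (c : C) (f : B) :
    twisting ρ (c ⊗ₜ f) = ρ c (f ⊗ₜ 1) := rfl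

variable {Y : Type} {y : Y → C} {ρ : C →ₐ[K] Module.End K (B ⊗[K] C)}

/-- The elements of `C` whose action commutes with `Z` form a subalgebra. -/
theorem commute_of_generators (hy : Algebra.adjoin K {c | ∃ j, y j = c} = ⊤)
    {Z : Module.End K (B ⊗[K] C)} (h : ∀ j z, ρ (y j) (Z z) = Z (ρ (y j) z)) (c : C)
    (z : B ⊗[K] C) : ρ c (Z z) = Z (ρ c z) := by
  have hc : c ∈ Algebra.adjoin K {c | ∃ j, y j = c} := by rw [hy]; trivial
  induction hc using Algebra.adjoin_induction generalizing z with
  | mem x hx =>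
    obtain ⟨j, rfl⟩ := hx
    exact h j z
  | algebraMap k => simp [Module.algebraMap_end_apply]
  | add x x' _ _ hx hx' => simp only [map_add, LinearMap.add_apply, hx, hx']
  | mul x x' _ _ hx hx' => simp only [map_mul, Module.End.mul_apply, hx, hx']

variable [Fintype Y] [DecidableEq Y] {Θ : B →ₐ[K] Matrix Y Y B}

theorem action_ract (hy : Algebra.adjoin K {c | ∃ j, y j = c} = ⊤)
    (hρ : ∀ j f c, ρ (y j) (f ⊗ₜ c) = ∑ k, Θ f j k ⊗ₜ (y k * c)) (c c' : C) (z : B ⊗[K] C) :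
    ρ c (ract B C c' z) = ract B C c' (ρ c z) := by
  refine commute_of_generators hy (Z := ract B C c') (fun j z => ?_) c z
  induction z with
  | zero => simp
  | add z w hz hw => simp only [map_add, hz, hw]
  | tmul f c => simp [hρ, mul_assoc]

/-- Multiplicativity of `Θ` in the form of a product rule; it is what gives the first diagram. -/
theorem action_lact (hρ : ∀ j f c, ρ (y j) (f ⊗ₜ c) = ∑ k, Θ f j k ⊗ₜ (y k * c)) (j : Y) (g : B)
    (z : B ⊗[K] C) : ρ (y j) (lact B C g z) = ∑ k, lact B C (Θ g j k) (ρ (y k) z) := by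
  induction z with
  | zero => simp
  | add z w hz hw => simp only [map_add, hz, hw, Finset.sum_add_distrib]
  | tmul f c =>
    simp only [lact_tmul, hρ, map_mul, Matrix.mul_apply, map_sum, TensorProduct.sum_tmul]
    exact Finset.sum_comm

theorem twisting_mul_left (hy : Algebra.adjoin K {c | ∃ j, y j = c} = ⊤)
    (hρ : ∀ j f c, ρ (y j) (f ⊗ₜ c) = ∑ k, Θ f j k ⊗ₜ (y k * c)) (c c' : C) (f : B) :
    twisting ρ ((c * c') ⊗ₜ f) = braidedMul (twisting ρ) ((1 ⊗ₜ c) ⊗ₜ twisting ρ (c' ⊗ₜ f)) := by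
  simp only [twisting_tmul, map_mul, Module.End.mul_apply]
  induction ρ c' (f ⊗ₜ 1) with
  | zero => simp
  | add z w hz hw => simp only [TensorProduct.tmul_add, map_add, hz, hw]
  | tmul g d =>
    rw [braidedMul_tmul, lact_one, twisting_tmul, ← action_ract hy hρ, ract_tmul, one_mul]

theorem twisting_mul_right (hy : Algebra.adjoin K {c | ∃ j, y j = c} = ⊤)
    (hρ : ∀ j f c, ρ (y j) (f ⊗ₜ c) = ∑ k, Θ f j k ⊗ₜ (y k * c)) (c : C) (f f' : B) :
    twisting ρ (c ⊗ₜ (f * f')) = braidedMul (twisting ρ) (twisting ρ (c ⊗ₜ f) ⊗ₜ (f' ⊗ₜ 1)) := by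
  -- `μ` is right multiplication by f' ⊗ 1. By the product rule it commutes with the action of the
  -- generators, hence with ρ(c); the claim is this commutation evaluated at f ⊗ 1.
  let μ : Module.End K (B ⊗[K] C) :=
    braidedMul (twisting ρ) ∘ₗ (TensorProduct.mk K _ _).flip (f' ⊗ₜ 1)
  have hμ : ∀ g d, μ (g ⊗ₜ d) = lact B C g (ρ d (f' ⊗ₜ 1)) := fun g d => by
    change braidedMul (twisting ρ) ((g ⊗ₜ d) ⊗ₜ (f' ⊗ₜ 1)) = _
    rw [braidedMul_tmul, ract_one, twisting_tmul]
  have h := commute_of_generators (ρ := ρ) hy (Z := μ) (fun j z => ?_) c (f ⊗ₜ 1)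
  · rw [hμ, map_one, Module.End.one_apply, lact_tmul] at h
    exact h
  · induction z with
    | zero => simp
    | add z w hz hw => simp only [map_add, hz, hw]
    | tmul g d => simp only [hμ, hρ, map_sum, action_lact hρ, map_mul, Module.End.mul_apply]

theorem twisting_one_left (f : B) : twisting ρ (1 ⊗ₜ f) = f ⊗ₜ 1 := by simp

theorem twisting_one_right (hy : Algebra.adjoin K {c | ∃ j, y j = c} = ⊤)
    (hρ : ∀ j f c, ρ (y j) (f ⊗ₜ c) = ∑ k, Θ f j k ⊗ₜ (y k * c)) (c : C) :
    twisting ρ (c ⊗ₜ 1) = 1 ⊗ₜ c := by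
  -- A general `d` is needed for the induction: in a product the left factor acts on 1 ⊗ x'd.
  have h : ∀ d : C, ρ c (1 ⊗ₜ d) = 1 ⊗ₜ (c * d) := by
    have hc : c ∈ Algebra.adjoin K {c | ∃ j, y j = c} := by rw [hy]; trivial
    induction hc using Algebra.adjoin_induction with
    | mem x hx =>
      obtain ⟨j, rfl⟩ := hx
      intro d
      rw [hρ, map_one, Finset.sum_eq_single j]
      · simp
      · intro k _ hk
        simp [Matrix.one_apply_ne hk.symm]
      · simp
    | algebraMap k =>
      intro d
      rw [AlgHom.commutes, Module.algebraMap_end_apply, ← TensorProduct.tmul_smul, Algebra.smul_def]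
    | add x x' _ _ hx hx' =>
      intro d
      simp only [map_add, LinearMap.add_apply, hx, hx', add_mul, TensorProduct.tmul_add]
    | mul x x' _ _ hx hx' =>
      intro d
      simp only [map_mul, Module.End.mul_apply, hx, hx', mul_assoc]
  rw [twisting_tmul, h, mul_one]

end Twisted

/-! ### The exchange homomorphism -/

/-- The homomorphism `Θ` with `Υ(T̄_y ⊗ f) = ∑_z Θ(f)_{yz} ⊗ T̄_z`. -/
def exchangeHom (r s n : ℕ) : A r n →ₐ[K] Matrix (I n × I s) (I n × I s) (A r n) :=
  (exists_lift_A (exchange r s n) exchange_opp (exchange_rtt r s n)).choose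

theorem exchangeHom_T {r s n : ℕ} (i : I r) (hi : 0 < i.1) (a : I n) :
    exchangeHom r s n (T r n i a) = exchangePos r s n i a := by
  rw [exchangeHom, (exists_lift_A (exchange r s n) exchange_opp (exchange_rtt r s n)).choose_spec,
    exchange, if_pos hi]

/-- The correction terms of `R_opp_fst` are cancelled by the passage from R to R - ξ. -/
theorem Rinv_opp_opp {n : ℕ} (b x a c : I n) :
    Rinv n (opp b, x) (a, opp c) = sg (pr x) * Rinv n (b, x) (a, c) := by
  have c1 : (opp b, x) = (a, opp c) ↔ a = opp b ∧ opp c = x := by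
    rw [Prod.mk.injEq]
    exact and_congr eq_comm eq_comm
  have c2 : (b, x) = (a, c) ↔ a = b ∧ opp c = opp x := by
    rw [Prod.mk.injEq, opp_eq_iff, opp_opp]
    exact and_congr eq_comm eq_comm
  simp only [Rinv, Matrix.sub_apply, Matrix.smul_apply, Matrix.one_apply, smul_eq_mul, R_opp_fst,
    opp_opp, c1, c2, mul_ite, mul_one, mul_zero]
  by_cases h : pr b + pr x = pr a + pr c
  · have : sg (pr b + pr a + pr (opp c) + 1) = sg (pr x) := by
      congr 1
      rw [pr_opp]
      generalize pr b = b, pr a = a, pr c = c, pr x = x at *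
      revert b a c x
      decide
    rw [this]
    split_ifs <;> ring
  · rw [R_even (u := (b, x)) (v := (a, c)) h]
    split_ifs <;> ring

/-- This makes the operators assigned to T̄ respect the symmetry of T̄ under negating both indices.
The property passes from generators to products by negating the summation index. -/
theorem exchangeHom_opp {r s n : ℕ} (f : A r n) (y z : I n × I s) :
    exchangeHom r s n f (opp y.1, opp y.2) (opp z.1, opp z.2) = exchangeHom r s n f y z := by
  have hf : f ∈ Algebra.adjoin K {x | ∃ (i : I r) (a : I n), 0 < i.1 ∧ T r n i a = x} := by
    rw [adjoin_T]; trivial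
  induction hf using Algebra.adjoin_induction generalizing y z with
  | mem x hx =>
    obtain ⟨i, a, hi, rfl⟩ := hx
    have e : opp y.2 = opp z.2 ↔ y.2 = z.2 := by rw [opp_eq_iff, opp_opp]
    simp only [exchangeHom_T i hi, exchangePos, e]
    congr 1
    refine Finset.sum_congr rfl fun x _ => ?_
    rw [Rinv_opp_opp, ← mul_assoc, ← sg_add]
    congr 3
    rw [pr_opp]
    generalize pr y.2 = b, pr a = a, pr x = x
    revert a b x
    decide
  | algebraMap k =>
    have e : (opp y.1, opp y.2) = (opp z.1, opp z.2) ↔ y = z := by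
      rw [Prod.mk.injEq, opp_eq_iff, opp_eq_iff, opp_opp, opp_opp, Prod.ext_iff]
    simp only [AlgHom.commutes, Matrix.algebraMap_matrix_apply, e]
  | add x x' _ _ hx hx' => simp only [map_add, Matrix.add_apply, hx, hx']
  | mul x x' _ _ hx hw =>
    rw [map_mul, Matrix.mul_apply, Matrix.mul_apply,
      ← Equiv.sum_comp ((oppEquiv n).prodCongr (oppEquiv s))]
    exact Finset.sum_congr rfl fun w _ => congrArg₂ (· * ·) (hx y w) (hw w z)

/-! ### The twofold exchange -/

/-- The sign of the entries of `prod21`. -/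
def sgn21 {M N : ℕ} (κ : (I M × I M) × (I N × I N)) : K :=
  sg ((pr κ.1.2 + pr κ.2.2) * pr κ.2.2 + (pr κ.1.1 + pr κ.2.1) * (pr κ.2.1 + pr κ.2.2))

theorem sgn21_mul_self {M N : ℕ} (κ : (I M × I M) × (I N × I N)) : sgn21 κ * sgn21 κ = 1 :=
  sg_mul_self _

/-- The twofold iteration of the exchange homomorphism. -/
def exchangeTwice (r s n : ℕ) :
    A r n →ₐ[K] Matrix ((I n × I n) × (I s × I s)) ((I n × I n) × (I s × I s)) (A r n) :=
  ((Matrix.reindexAlgEquiv K (A r n) (Equiv.prodProdProdComm (I n) (I s) (I n) (I s))).toAlgHom.comp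
    (Matrix.compAlgEquiv (I n × I s) (I n × I s) (A r n) K).toAlgHom).comp
      ((exchangeHom r s n).mapMatrix.comp (exchangeHom r s n))

theorem exchangeTwice_apply {r s n : ℕ} (f : A r n) (κ μ : (I n × I n) × (I s × I s)) :
    exchangeTwice r s n f κ μ = exchangeHom r s n
      (exchangeHom r s n f (κ.1.1, κ.2.1) (μ.1.1, μ.2.1)) (κ.1.2, κ.2.2) (μ.1.2, μ.2.2) := rfl

theorem leg23_mul_leg12_apply {n : ℕ} (P Q : Matrix (I n × I n) (I n × I n) K)
    (b c x a d e : I n) :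
    (leg23 P * leg12 Q) (b, c, x) (a, d, e) = ∑ z, P (c, x) (z, e) * Q (b, z) (a, d) := by
  simp only [Matrix.mul_apply, leg12, leg23, Fintype.sum_prod_type, ite_mul, mul_ite, zero_mul,
    mul_zero]
  simp

/-- With the signs of `prod21` included, two T̄'s moving past one T give R⁻¹₂₃R⁻¹₁₂ on row indices.
The column indices are unchanged and enter only through their total parity. -/
theorem exchangeTwice_T {r s n : ℕ} (i : I r) (hi : 0 < i.1) (a : I n)
    (κ μ : (I n × I n) × (I s × I s)) :
    (sgn21 κ * sgn21 μ) • exchangeTwice r s n (T r n i a) κ μ =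
      if κ.2 = μ.2 then ∑ x, (sg ((pr κ.2.1 + pr κ.2.2 + 1) * pr a + pr x) *
        (leg23 (Rinv n) * leg12 (Rinv n)) (κ.1.1, κ.1.2, x) (a, μ.1.1, μ.1.2)) • T r n i x
      else 0 := by
  obtain ⟨⟨b, c⟩, α, β⟩ := κ
  obtain ⟨⟨b', c'⟩, α', β'⟩ := μ
  rw [exchangeTwice_apply, exchangeHom_T i hi]
  simp only [exchangePos]
  by_cases hα : α = α'
  swap
  · simp [hα]
  subst hα
  simp only [if_true, map_sum, map_smul, exchangeHom_T i hi, Matrix.sum_apply, Matrix.smul_apply,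
    exchangePos]
  by_cases hβ : β = β'
  swap
  · simp [hβ]
  subst hβ
  simp only [if_true, Finset.smul_sum, smul_smul]
  rw [Finset.sum_comm]
  refine Finset.sum_congr rfl fun x _ => ?_
  rw [← Finset.sum_smul]
  congr 1
  rw [leg23_mul_leg12_apply, Finset.mul_sum]
  refine Finset.sum_congr rfl fun z _ => ?_
  by_cases h1 : pr b + pr z = pr a + pr b'
  swap
  · rw [Rinv_even (u := (b, z)) (v := (a, b')) h1]
    ring
  by_cases h2 : pr c + pr x = pr z + pr c'
  swap
  · rw [Rinv_even (u := (c, x)) (v := (z, c')) h2]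
    ring
  have h : sgn21 ((b, c), α, β) * sgn21 ((b', c'), α, β) *
      (sg ((pr α + 1) * pr z + pr a) * sg ((pr β + 1) * pr x + pr z)) =
      sg ((pr α + pr β + 1) * pr a + pr x) := by
    simp only [sgn21, ← sg_add]
    congr 1
    -- A nonzero entry of R⁻¹ preserves total parity, which determines the parities of z and a.
    have h3 : pr z = pr c + pr x + pr c' := by
      clear h1
      generalize pr z = z, pr c = c, pr x = x, pr c' = c' at *
      revert z c x c'
      decide
    have h4 : pr a = pr b + pr z + pr b' := by
      clear h2 h3
      generalize pr z = z, pr a = a, pr b = x, pr b' = c' at *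
      revert z a x c'
      decide
    rw [h4, h3]
    generalize pr b = b, pr c = c, pr b' = b', pr c' = c', pr x = x, pr α = α, pr β = β
    revert b c b' c' x α β
    decide
  rw [← h]
  ring

/-- The matrix `R ⊗ 1` on the row indices. -/
def rowR (s n : ℕ) : Matrix ((I n × I n) × (I s × I s)) ((I n × I n) × (I s × I s)) K :=
  fun κ μ => if κ.2 = μ.2 then R n κ.1 μ.1 else 0

/-- The transpose of `1 ⊗ R` on the column indices. -/
def colR (s n : ℕ) : Matrix ((I n × I n) × (I s × I s)) ((I n × I n) × (I s × I s)) K :=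
  fun κ μ => if κ.1 = μ.1 then R s μ.2 κ.2 else 0

/-- The twofold exchange of the matrix `prod21`. -/
def exchange21 (r s n : ℕ) (f : A r n) :
    Matrix ((I n × I n) × (I s × I s)) ((I n × I n) × (I s × I s)) (A r n) :=
  fun κ μ => (sgn21 κ * sgn21 μ) • exchangeTwice r s n f κ μ

/-- Conjugation by a diagonal matrix of signs preserves multiplicativity. Commutation with a fixed
matrix can therefore be tested on generators. -/
theorem exchange21_mul {r s n : ℕ} (f g : A r n) :
    exchange21 r s n (f * g) = exchange21 r s n f * exchange21 r s n g := by
  ext κ μ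
  simp only [exchange21, map_mul, Matrix.mul_apply, Finset.smul_sum, smul_mul_smul_comm]
  refine Finset.sum_congr rfl fun ν _ => ?_
  congr 1
  linear_combination -sgn21 κ * sgn21 μ * sgn21_mul_self ν

theorem exchange21_add {r s n : ℕ} (f g : A r n) :
    exchange21 r s n (f + g) = exchange21 r s n f + exchange21 r s n g := by
  ext κ μ
  simp only [exchange21, map_add, Matrix.add_apply, smul_add]

theorem exchange21_algebraMap {r s n : ℕ} (k : K) :
    exchange21 r s n (algebraMap K _ k) = algebraMap K _ k := by
  ext κ μ
  simp only [exchange21, AlgHom.commutes, Matrix.algebraMap_matrix_apply]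
  split_ifs with h
  · rw [h, sgn21_mul_self, one_smul]
  · rw [smul_zero]

theorem commute_exchange21 {r s n : ℕ}
    (P : Matrix ((I n × I n) × (I s × I s)) ((I n × I n) × (I s × I s)) (A r n))
    (h : ∀ i a, 0 < i.1 → P * exchange21 r s n (T r n i a) = exchange21 r s n (T r n i a) * P)
    (f : A r n) : P * exchange21 r s n f = exchange21 r s n f * P := by
  have hf : f ∈ Algebra.adjoin K {x | ∃ (i : I r) (a : I n), 0 < i.1 ∧ T r n i a = x} := by
    rw [adjoin_T]; trivial
  induction hf using Algebra.adjoin_induction with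
  | mem x hx =>
    obtain ⟨i, a, hi, rfl⟩ := hx
    exact h i a hi
  | algebraMap k => rw [exchange21_algebraMap, Algebra.commutes]
  | add x x' _ _ hx hx' => rw [exchange21_add, mul_add, add_mul, hx, hx']
  | mul x x' _ _ hx hx' => rw [exchange21_mul, ← mul_assoc, hx, mul_assoc, hx', mul_assoc]

theorem leg12_mul_apply {n : ℕ} (G : Matrix (I n × I n × I n) (I n × I n × I n) K)
    (P : Matrix (I n × I n) (I n × I n) K) (b c x : I n) (v : I n × I n × I n) :
    (leg12 P * G) (b, c, x) v = ∑ u : I n × I n, P (b, c) u * G (u.1, u.2, x) v := by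
  simp only [Matrix.mul_apply, leg12, Fintype.sum_prod_type, ite_mul, zero_mul]
  simp

theorem mul_leg23_apply {n : ℕ} (G : Matrix (I n × I n × I n) (I n × I n × I n) K)
    (P : Matrix (I n × I n) (I n × I n) K) (v : I n × I n × I n) (a : I n) (w : I n × I n) :
    (G * leg23 P) v (a, w) = ∑ u, G v (a, u) * P u w := by
  simp only [Matrix.mul_apply, leg23, Fintype.sum_prod_type, mul_ite, mul_zero]
  simp

/-- On generators this is the braid relation in the form `Rinv_Rinv_R'`; the sign does not involve
the row indices. -/
theorem rowR_commute {r s n : ℕ} (f : A r n) :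
    (rowR s n).map (algebraMap K (A r n)) * exchange21 r s n f =
      exchange21 r s n f * (rowR s n).map (algebraMap K (A r n)) := by
  refine commute_exchange21 _ (fun i a hi => ?_) f
  ext ⟨u, v⟩ ⟨u', v'⟩
  simp only [map_mul_apply, mul_map_apply, exchange21, exchangeTwice_T i hi, rowR,
    Fintype.sum_prod_type (α₂ := I s × I s), ite_smul, zero_smul, Finset.sum_ite_eq,
    Finset.sum_ite_eq', Finset.mem_univ, if_true]
  by_cases h : v = v'
  swap
  · simp [h]
  simp only [h, if_true, Finset.smul_sum, smul_smul]
  conv_lhs => rw [Finset.sum_comm]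
  conv_rhs => rw [Finset.sum_comm]
  refine Finset.sum_congr rfl fun x _ => ?_
  rw [← Finset.sum_smul, ← Finset.sum_smul]
  congr 1
  have e := congrFun (congrFun (Rinv_Rinv_R' n) (u.1, u.2, x)) (a, u')
  rw [mul_leg23_apply, leg12_mul_apply] at e
  have e' := congrArg (fun t => sg ((pr v'.1 + pr v'.2 + 1) * pr a + pr x) * t) e
  simp only [Finset.mul_sum] at e'
  refine Eq.trans (Finset.sum_congr rfl fun w _ => ?_)
    (e'.symm.trans (Finset.sum_congr rfl fun w _ => ?_)) <;> ring

/-- On generators the twofold exchange is diagonal in the column indices and depends only on their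
total parity, which R preserves. -/
theorem colR_commute {r s n : ℕ} (f : A r n) :
    (colR s n).map (algebraMap K (A r n)) * exchange21 r s n f =
      exchange21 r s n f * (colR s n).map (algebraMap K (A r n)) := by
  refine commute_exchange21 _ (fun i a hi => ?_) f
  ext ⟨u, v⟩ ⟨u', v'⟩
  simp only [map_mul_apply, mul_map_apply, exchange21, exchangeTwice_T i hi, colR,
    Fintype.sum_prod_type_right (α₁ := I n × I n), ite_smul, zero_smul, Finset.sum_ite_eq,
    Finset.sum_ite_eq', Finset.mem_univ, if_true]
  simp only [smul_ite, smul_zero, Finset.sum_ite_eq, Finset.sum_ite_eq', Finset.mem_univ, if_true]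
  by_cases h : pr v.1 + pr v.2 = pr v'.1 + pr v'.2
  · simp only [h]
  · rw [R_even (u := v') (v := v) (Ne.symm h), zero_smul, zero_smul]

/-! ### The action of `Ā_{s,n}` on the tensor product -/

/-- The operator by which `T̄_y` acts. -/
def actGen (r s n : ℕ) (y : I n × I s) : Module.End K (A r n ⊗[K] Abar s n) :=
  ∑ z : I n × I s, TensorProduct.map
    (Matrix.entryLinearMap K (A r n) y z ∘ₗ (exchangeHom r s n).toLinearMap)
    (LinearMap.mulLeft K (Tbar s n z.1 z.2))

theorem actGen_tmul {r s n : ℕ} (y : I n × I s) (f : A r n) (c : Abar s n) :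
    actGen r s n y (f ⊗ₜ c) =
      ∑ z : I n × I s, exchangeHom r s n f y z ⊗ₜ (Tbar s n z.1 z.2 * c) := by
  simp only [actGen, LinearMap.sum_apply, TensorProduct.map_tmul]
  rfl

theorem actGen_opp {r s n : ℕ} (b : I n) (α : I s) :
    actGen r s n (opp b, opp α) = actGen r s n (b, α) := by
  apply TensorProduct.ext'
  intro f c
  rw [actGen_tmul, actGen_tmul, ← Equiv.sum_comp ((oppEquiv n).prodCongr (oppEquiv s))]
  refine Finset.sum_congr rfl fun z _ => ?_
  exact congrArg₂ (fun x y => x ⊗ₜ (y * c)) (exchangeHom_opp f (b, α) z) (Tbar_opp s n z.1 z.2)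

/-- The operators `actGen`, arranged as the matrix `T̄`. -/
def actMatrix (r s n : ℕ) : Matrix (I n) (I s) (Module.End K (A r n ⊗[K] Abar s n)) :=
  fun b α => actGen r s n (b, α)

/-- The first T̄ acts before the second, which is the order in `exchangeTwice`. The sign at `μ` in
`exchange21` compensates the one in `prod21` of `Tbar`. -/
theorem prod21_actMatrix {r s n : ℕ} (κ : (I n × I n) × (I s × I s)) (f : A r n) (c : Abar s n) :
    prod21 (actMatrix r s n) κ.1 κ.2 (f ⊗ₜ c) =
      ∑ μ, exchange21 r s n f κ μ ⊗ₜ (prod21 (Tbar s n) μ.1 μ.2 * c) := by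
  have h : prod21 (actMatrix r s n) κ.1 κ.2 = sgn21 κ •
      (actGen r s n (κ.1.2, κ.2.2) * actGen r s n (κ.1.1, κ.2.1)) := rfl
  rw [h, LinearMap.smul_apply, Module.End.mul_apply, actGen_tmul, map_sum,
    ← Equiv.sum_comp (Equiv.prodProdProdComm (I n) (I s) (I n) (I s)),
    Fintype.sum_prod_type (α₁ := I n × I s),
    Finset.smul_sum]
  refine Finset.sum_congr rfl fun z _ => ?_
  rw [actGen_tmul, Finset.smul_sum]
  refine Finset.sum_congr rfl fun w _ => ?_
  have h' : prod21 (Tbar s n) (z.1, w.1) (z.2, w.2) =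
    sgn21 ((z.1, w.1), (z.2, w.2)) • (Tbar s n w.1 w.2 * Tbar s n z.1 z.2) := rfl
  change _ = exchange21 r s n f κ ((z.1, w.1), (z.2, w.2)) ⊗ₜ
    (prod21 (Tbar s n) (z.1, w.1) (z.2, w.2) * c)
  rw [h', exchange21, exchangeTwice_apply, smul_mul_assoc, TensorProduct.tmul_smul,
    ← TensorProduct.smul_tmul', smul_smul, mul_left_comm, sgn21_mul_self, mul_one, mul_assoc]

theorem sum_smul_prod21_actMatrix {r s n : ℕ}
    (Q : Matrix ((I n × I n) × (I s × I s)) ((I n × I n) × (I s × I s)) K) (f : A r n)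
    (hQ : Q.map (algebraMap K (A r n)) * exchange21 r s n f =
      exchange21 r s n f * Q.map (algebraMap K (A r n)))
    (κ : (I n × I n) × (I s × I s)) (c : Abar s n) :
    ∑ μ, Q κ μ • prod21 (actMatrix r s n) μ.1 μ.2 (f ⊗ₜ c) =
      ∑ μ, exchange21 r s n f κ μ ⊗ₜ ((∑ ν, Q μ ν • prod21 (Tbar s n) ν.1 ν.2) * c) := by
  have h : ∀ ν, ∑ μ, Q κ μ • exchange21 r s n f μ ν = ∑ μ, Q μ ν • exchange21 r s n f κ μ := by
    intro ν
    have := congrFun (congrFun hQ κ) ν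
    rwa [map_mul_apply, mul_map_apply] at this
  simp only [prod21_actMatrix, Finset.smul_sum, TensorProduct.smul_tmul', Finset.sum_mul,
    TensorProduct.tmul_sum, smul_mul_assoc, TensorProduct.tmul_smul]
  conv_lhs => rw [Finset.sum_comm]
  conv_rhs => rw [Finset.sum_comm]
  refine Finset.sum_congr rfl fun ν _ => ?_
  rw [← TensorProduct.sum_tmul, ← TensorProduct.sum_tmul, h]

theorem sum_rowR_smul {s n : ℕ} {V : Type} [AddCommMonoid V] [Module K V]
    (P : (I n × I n) × (I s × I s) → V) (κ : (I n × I n) × (I s × I s)) :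
    ∑ μ, rowR s n κ μ • P μ = ∑ x, R n κ.1 x • P (x, κ.2) := by
  simp only [rowR, Fintype.sum_prod_type (α₂ := I s × I s), ite_smul, zero_smul, Finset.sum_ite_eq,
    Finset.mem_univ, if_true]

theorem sum_colR_smul {s n : ℕ} {V : Type} [AddCommMonoid V] [Module K V]
    (P : (I n × I n) × (I s × I s) → V) (κ : (I n × I n) × (I s × I s)) :
    ∑ μ, colR s n κ μ • P μ = ∑ x, R s x κ.2 • P (κ.1, x) := by
  simp only [colR, Fintype.sum_prod_type_right (α₁ := I n × I n), ite_smul, zero_smul,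
    Finset.sum_ite_eq, Finset.mem_univ, if_true]

/-- R on rows and R on columns both pass through the twofold exchange and reach the product of the
two T̄'s, where they agree by the relation in `Abar s n`. -/
theorem actMatrix_rtt (r s n : ℕ) :
    (R n).map (algebraMap K (Module.End K (A r n ⊗[K] Abar s n))) * prod21 (actMatrix r s n) =
      prod21 (actMatrix r s n) *
        (R s).map (algebraMap K (Module.End K (A r n ⊗[K] Abar s n))) := by
  refine Matrix.ext fun u v => ?_
  refine (map_mul_apply _ _ u v).trans (Eq.trans ?_ (mul_map_apply _ _ u v).symm)
  apply TensorProduct.ext'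
  intro f c
  simp only [LinearMap.sum_apply, LinearMap.smul_apply]
  rw [← sum_rowR_smul (fun μ => prod21 (actMatrix r s n) μ.1 μ.2 (f ⊗ₜ c)) (u, v),
    ← sum_colR_smul (fun μ => prod21 (actMatrix r s n) μ.1 μ.2 (f ⊗ₜ c)) (u, v),
    sum_smul_prod21_actMatrix _ f (rowR_commute f), sum_smul_prod21_actMatrix _ f (colR_commute f)]
  refine Finset.sum_congr rfl fun μ _ => ?_
  rw [sum_rowR_smul (fun ν => prod21 (Tbar s n) ν.1 ν.2),
    sum_colR_smul (fun ν => prod21 (Tbar s n) ν.1 ν.2)]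
  have := congrFun (congrFun (Tbar_rtt s n) μ.1) μ.2
  rw [map_mul_apply, mul_map_apply] at this
  rw [this]

/-- The action of `Ā_{s,n}` on `A_{r,n} ⊗ Ā_{s,n}` that defines the braiding. -/
def action (r s n : ℕ) : Abar s n →ₐ[K] Module.End K (A r n ⊗[K] Abar s n) :=
  (exists_lift_Abar (actMatrix r s n) actGen_opp (actMatrix_rtt r s n)).choose

theorem action_Tbar {r s n : ℕ} (y : I n × I s) (f : A r n) (c : Abar s n) :
    action r s n (Tbar s n y.1 y.2) (f ⊗ₜ c) =
      ∑ z : I n × I s, exchangeHom r s n f y z ⊗ₜ (Tbar s n z.1 z.2 * c) := by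
  rw [action,
    (exists_lift_Abar (actMatrix r s n) actGen_opp (actMatrix_rtt r s n)).choose_spec]
  exact actGen_tmul y f c

/-- The braiding `Υ`. -/
def braiding (r s n : ℕ) : Abar s n ⊗[K] A r n →ₗ[K] A r n ⊗[K] Abar s n := twisting (action r s n)

theorem braiding_Tbar_tmul {r s n : ℕ} (b : I n) (α : I s) (f : A r n) :
    braiding r s n (Tbar s n b α ⊗ₜ f) =
      ∑ z : I n × I s, exchangeHom r s n f (b, α) z ⊗ₜ Tbar s n z.1 z.2 := by
  rw [braiding, twisting_tmul, action_Tbar (b, α)]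
  simp only [mul_one]

/-! ### The exchange relation in matrix form -/

theorem unsign_Sinv {N : ℕ} (i j k l : I N) :
    unsign (Sinv N) (i, j) (k, l) = sg (pr k * pr l) * Rinv N (i, j) (l, k) := by
  rw [← sg_mul_Sinv, unsign, smul_eq_mul]
  by_cases h : pr i + pr j = pr k + pr l
  · congr 2
    simp only [twist]
    generalize pr i = a, pr j = b, pr k = c, pr l = d at *
    revert a b c d
    decide
  · have h0 : Sinv N (i, j) (k, l) = 0 := by
      have h1 := sg_mul_Sinv i j k l
      rw [Rinv_even (by rwa [add_comm (pr l)]), mul_zero] at h1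
      exact (mul_eq_zero.1 h1).resolve_left (sg_ne_zero _)
    simp [h0]

theorem unsign_tmulM_Tbar_Tplus {r s n : ℕ} (b : I n) (i : IPos r) (α : I s) (a : I n) :
    unsign (tmulM (leg1 (L₁ := IPos r) (Tbar s n)) (leg2 (L₁ := I s) (Tplus r n))) (b, i) (α, a) =
      sg ((pr b + pr α) * pr α + pr a) • (Tbar s n b α ⊗ₜ[K] T r n i.1 a) := by
  rw [tmulM, unsign_superMul, Finset.sum_eq_single (α, i)]
  · simp only [unsign, leg1, leg2, if_true, Tplus, TensorProduct.mk_apply,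
      TensorProduct.smul_tmul_smul, ← sg_add]
    congr 2
    simp only [twist, pr_pos]
    generalize pr b = b, pr α = c, pr a = a
    revert a b c
    decide
  · rintro ⟨β, j⟩ - h
    by_cases h1 : i = j
    · have h2 : β ≠ α := fun h2 => h (by rw [h1, h2])
      simp [unsign, leg2, h2]
    · simp [unsign, leg1, h1]
  · simp

theorem unsign_tmulM_Tplus_Sinv_Tbar {r s n : ℕ} (b : I n) (i : IPos r) (α : I s) (a : I n) :
    unsign (tmulM (rscal (leg2 (L₁ := I n) (Tplus r n)) (Sinv n))
        (leg1 (L₁ := I n) (Tbar s n))) (b, i) (α, a) =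
      ∑ c, ∑ x, (sg ((pr b + pr α) * pr α + pr a) * (sg ((pr α + 1) * pr x + pr a) *
        Rinv n (b, x) (a, c))) • (T r n i.1 x ⊗ₜ[K] Tbar s n c α) := by
  have hX : ∀ v : I n × I n, unsign (rscal (leg2 (L₁ := I n) (Tplus r n)) (Sinv n)) (b, i) v =
      ∑ x, (sg (pr x) * (sg (pr v.1 * pr v.2) * Rinv n (b, x) (v.2, v.1))) • T r n i.1 x := by
    rintro ⟨k, l⟩
    rw [rscal, unsign_superMul, Fintype.sum_prod_type, Finset.sum_eq_single b]
    · refine Finset.sum_congr rfl fun x _ => ?_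
      rw [unsign_Sinv]
      simp only [unsign, leg2, if_true, Tplus, LinearMap.flip_apply, LinearMap.lsmul_apply,
        smul_smul]
      congr 1
      rw [mul_comm]
      congr 2
      simp only [twist, pr_pos]
      generalize pr b = b, pr x = a
      revert a b
      decide
    · intro c _ h
      refine Finset.sum_eq_zero fun x _ => ?_
      simp [unsign, leg2, h.symm]
    · simp
  rw [tmulM, unsign_superMul, Fintype.sum_prod_type]
  refine Finset.sum_congr rfl fun c _ => ?_
  rw [Finset.sum_eq_single a]
  · rw [hX]
    simp only [unsign, leg1, if_true, TensorProduct.mk_apply, TensorProduct.sum_tmul,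
      TensorProduct.smul_tmul_smul]
    refine Finset.sum_congr rfl fun x _ => ?_
    congr 1
    -- The signs need to match only where the entry of R⁻¹ is nonzero.
    by_cases h : pr b + pr x = pr a + pr c
    · have e : sg (pr x) * (sg (pr c * pr a) * sg (twist (c, a) (α, a))) =
          sg ((pr b + pr α) * pr α + pr a) * sg ((pr α + 1) * pr x + pr a) := by
        simp only [← sg_add]
        congr 1
        simp only [twist]
        generalize pr b = b, pr x = x, pr a = a, pr c = c, pr α = d at *
        revert a b c d x
        decide
      linear_combination Rinv n (b, x) (a, c) * e
    · rw [Rinv_even (u := (b, x)) (v := (a, c)) h]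
      ring
  · intro d _ h
    simp [unsign, leg1, h]
  · simp

theorem map_braiding_tmulM (r s n : ℕ) :
    (tmulM (leg1 (L₁ := IPos r) (Tbar s n)) (leg2 (L₁ := I s) (Tplus r n))).map (braiding r s n) =
      tmulM (rscal (leg2 (L₁ := I n) (Tplus r n)) (Sinv n)) (leg1 (L₁ := I n) (Tbar s n)) := by
  apply unsign_injective
  ext ⟨b, i⟩ ⟨α, a⟩
  rw [unsign_tmulM_Tplus_Sinv_Tbar]
  refine (map_smul (braiding r s n) _ _).symm.trans ?_
  refine (congrArg (braiding r s n) (unsign_tmulM_Tbar_Tplus b i α a)).trans ?_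
  rw [map_smul, braiding_Tbar_tmul, exchangeHom_T i.1 i.2, Fintype.sum_prod_type, Finset.smul_sum]
  refine Finset.sum_congr rfl fun c _ => ?_
  rw [Finset.sum_eq_single α]
  · simp only [exchangePos, if_true, TensorProduct.sum_tmul, ← TensorProduct.smul_tmul',
      Finset.smul_sum, smul_smul]
  · intro β _ h
    simp only [exchangePos, h.symm, if_false, TensorProduct.zero_tmul]
  · simp

/-! ### Parities -/

section WordSpan

variable {ι B : Type} [Semiring B] [Algebra K B] (t : ι → B) (p : ι → ZMod 2)

/-- The span of the monomials of parity `ε` in elements `t j` of parity `p j`. -/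
def wordSpan (ε : ZMod 2) : Submodule K B :=
  Submodule.span K {x | ∃ w : List ι, (w.map p).sum = ε ∧ (w.map t).prod = x}

theorem one_mem_wordSpan : (1 : B) ∈ wordSpan t p 0 := Submodule.subset_span ⟨[], rfl, rfl⟩

theorem mem_wordSpan (j : ι) : t j ∈ wordSpan t p (p j) :=
  Submodule.subset_span ⟨[j], by simp, by simp⟩

variable {t p}

theorem mul_mem_wordSpan {δ ε : ZMod 2} {x y : B} (hx : x ∈ wordSpan t p δ)
    (hy : y ∈ wordSpan t p ε) : x * y ∈ wordSpan t p (δ + ε) := by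
  have h := Submodule.mul_mem_mul hx hy
  rw [wordSpan, wordSpan, Submodule.span_mul_span] at h
  refine Submodule.span_mono ?_ h
  rintro _ ⟨_, ⟨w, hw, rfl⟩, _, ⟨w', hw', rfl⟩, rfl⟩
  exact ⟨w ++ w', by simp [hw, hw'], by simp⟩


end WordSpan

/-! ### The braiding is even -/

theorem gradeA_eq (r n : ℕ) (ε : ZMod 2) : gradeA r n ε =
    wordSpan (fun p : I r × I n => T r n p.1 p.2) (fun p => pr p.1 + pr p.2) ε := by
  simp only [gradeA, wordSpan, Nat.cast_add, cast_par]

theorem gradeAbar_eq (s n : ℕ) (ε : ZMod 2) : gradeAbar s n ε =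
    wordSpan (fun p : I s × I n => tbar s n p.1 p.2) (fun p => pr p.1 + pr p.2) ε := by
  simp only [gradeAbar, wordSpan, Nat.cast_add, cast_par]

theorem T_mem_gradeA {r n : ℕ} (i : I r) (a : I n) : T r n i a ∈ gradeA r n (pr i + pr a) := by
  rw [gradeA_eq]
  exact mem_wordSpan (fun p : I r × I n => T r n p.1 p.2) (fun p => pr p.1 + pr p.2) (i, a)

theorem Tbar_mul_mem_gradeAbar {s n : ℕ} (b : I n) (α : I s) {ε : ZMod 2} {c : Abar s n}
    (hc : c ∈ gradeAbar s n ε) : Tbar s n b α * c ∈ gradeAbar s n (pr b + pr α + ε) := by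
  rw [gradeAbar_eq] at hc ⊢
  rw [Tbar, smul_mul_assoc, add_comm (pr b)]
  exact Submodule.smul_mem _ _ (mul_mem_wordSpan (mem_wordSpan
    (fun p : I s × I n => tbar s n p.1 p.2) (fun p => pr p.1 + pr p.2) (α, b)) hc)

theorem exchangePos_mem_gradeA {r s n : ℕ} (i : I r) (a : I n) (y z : I n × I s) :
    exchangePos r s n i a y z ∈
      gradeA r n (pr i + pr a + (pr y.1 + pr y.2) + (pr z.1 + pr z.2)) := by
  rw [exchangePos]
  split_ifs with hyz
  swap
  · exact zero_mem _
  refine Submodule.sum_mem _ fun x _ => ?_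
  by_cases h : pr y.1 + pr x = pr a + pr z.1
  swap
  · rw [Rinv_even (u := (y.1, x)) (v := (a, z.1)) h, mul_zero, zero_smul]
    exact zero_mem _
  have e : pr i + pr a + (pr y.1 + pr y.2) + (pr z.1 + pr z.2) = pr i + pr x := by
    rw [hyz]
    clear hyz
    generalize pr i = i, pr a = a, pr y.1 = b, pr z.1 = c, pr z.2 = d, pr x = x at *
    revert i a b c d x
    decide
  rw [e]
  exact Submodule.smul_mem _ _ (T_mem_gradeA i x)

theorem exchangeHom_T_mem_gradeA {r s n : ℕ} (i : I r) (a : I n) (y z : I n × I s) :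
    exchangeHom r s n (T r n i a) y z ∈
      gradeA r n (pr i + pr a + (pr y.1 + pr y.2) + (pr z.1 + pr z.2)) := by
  by_cases hi : 0 < i.1
  · rw [exchangeHom_T i hi]
    exact exchangePos_mem_gradeA i a y z
  · have := val_ne_zero i
    rw [← T_opp, exchangeHom_T (opp i) (by rw [opp_val]; omega)]
    have h := exchangePos_mem_gradeA (opp i) (opp a) y z
    have e : pr (opp i) + pr (opp a) = pr i + pr a := by
      rw [pr_opp, pr_opp]
      generalize pr i = i, pr a = a
      revert i a
      decide
    rwa [e] at h

/-- The parities of `y` and `z` enter because the sum of Θ(f)_{yz} ⊗ T̄_z must have the parity of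
T̄_y ⊗ f. For products the parity of the intermediate index appears twice and cancels. -/
theorem exchangeHom_mem_gradeA {r s n : ℕ} {η : ZMod 2} {f : A r n} (hf : f ∈ gradeA r n η)
    (y z : I n × I s) : exchangeHom r s n f y z ∈
      gradeA r n (η + (pr y.1 + pr y.2) + (pr z.1 + pr z.2)) := by
  rw [gradeA_eq, wordSpan] at hf
  induction hf using Submodule.span_induction with
  | mem x hx =>
    obtain ⟨w, rfl, rfl⟩ := hx
    induction w generalizing y z with
    | nil =>
      simp only [List.map_nil, List.prod_nil, map_one, Matrix.one_apply, List.sum_nil]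
      split_ifs with h
      · rw [h, zero_add, CharTwo.add_self_eq_zero, gradeA_eq]
        exact one_mem_wordSpan _ _
      · exact zero_mem _
    | cons p w ih =>
      simp only [List.map_cons, List.prod_cons, map_mul, Matrix.mul_apply, List.sum_cons]
      refine Submodule.sum_mem _ fun v _ => ?_
      have h1 := exchangeHom_T_mem_gradeA p.1 p.2 y v
      have h2 := ih v z
      rw [gradeA_eq] at h1 h2 ⊢
      convert mul_mem_wordSpan h1 h2 using 2
      generalize (w.map fun p => pr p.1 + pr p.2).sum = η
      generalize pr p.1 + pr p.2 = a, pr y.1 + pr y.2 = b, pr v.1 + pr v.2 = c,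
        pr z.1 + pr z.2 = d
      revert a b c d η
      decide
  | zero => simp
  | add x x' _ _ hx hx' =>
    rw [map_add]
    exact add_mem hx hx'
  | smul k x _ hx =>
    rw [map_smul]
    exact Submodule.smul_mem _ k hx

theorem action_tbar_mem {r s n : ℕ} (α : I s) (b : I n) {ε : ZMod 2} {x : A r n ⊗[K] Abar s n}
    (hx : x ∈ gradeTensor (gradeA r n) (gradeAbar s n) ε) :
    action r s n (tbar s n α b) x ∈
      gradeTensor (gradeA r n) (gradeAbar s n) (pr α + pr b + ε) := by
  rw [tbar_eq, map_smul, LinearMap.smul_apply]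
  refine Submodule.smul_mem _ _ ?_
  induction hx using Submodule.span_induction with
  | mem x hx =>
    obtain ⟨δ, η, rfl, f, hf, c, hc, rfl⟩ := hx
    rw [action_Tbar (b, α)]
    refine Submodule.sum_mem _ fun z _ => Submodule.subset_span
      ⟨_, _, ?_, _, exchangeHom_mem_gradeA hf (b, α) z, _, Tbar_mul_mem_gradeAbar z.1 z.2 hc, rfl⟩
    clear hf hc
    generalize pr z.1 = z, pr z.2 = w, pr b = b, pr α = a
    revert z w a b δ η
    decide
  | zero => simp
  | add x x' _ _ hx hx' =>
    rw [map_add]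
    exact add_mem hx hx'
  | smul k x _ hx =>
    rw [map_smul]
    exact Submodule.smul_mem _ k hx

theorem action_mem {r s n : ℕ} {δ ε : ZMod 2} {c : Abar s n} (hc : c ∈ gradeAbar s n δ)
    {x : A r n ⊗[K] Abar s n} (hx : x ∈ gradeTensor (gradeA r n) (gradeAbar s n) ε) :
    action r s n c x ∈ gradeTensor (gradeA r n) (gradeAbar s n) (δ + ε) := by
  rw [gradeAbar_eq, wordSpan] at hc
  induction hc using Submodule.span_induction with
  | mem c hc =>
    obtain ⟨w, rfl, rfl⟩ := hc
    induction w with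
    | nil => simpa using hx
    | cons p w ih =>
      simp only [List.map_cons, List.prod_cons, map_mul, Module.End.mul_apply, List.sum_cons]
      have h := action_tbar_mem p.1 p.2 ih
      rwa [← add_assoc] at h
  | zero => simp
  | add c c' _ _ hc hc' =>
    rw [map_add, LinearMap.add_apply]
    exact add_mem hc hc'
  | smul k c _ hc =>
    rw [map_smul, LinearMap.smul_apply]
    exact Submodule.smul_mem _ k hc

theorem braiding_mem {r s n : ℕ} {ε : ZMod 2} {z : Abar s n ⊗[K] A r n}
    (hz : z ∈ gradeTensor (gradeAbar s n) (gradeA r n) ε) :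
    braiding r s n z ∈ gradeTensor (gradeA r n) (gradeAbar s n) ε := by
  induction hz using Submodule.span_induction with
  | mem z hz =>
    obtain ⟨δ, η, rfl, c, hc, f, hf, rfl⟩ := hz
    rw [braiding, twisting_tmul]
    refine action_mem hc (Submodule.subset_span ⟨η, 0, add_zero η, f, hf, 1, ?_, rfl⟩)
    rw [gradeAbar_eq]
    exact one_mem_wordSpan _ _
  | zero => simp
  | add x x' _ _ hx hx' =>
    rw [map_add]
    exact add_mem hx hx'
  | smul k x _ hx =>
    rw [map_smul]
    exact Submodule.smul_mem _ k hx

end QueerSuper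

end

/-! ### Assembly of the proposition -/

open QueerSuper in
theorem proposition3 (r s n : ℕ) :
    ∃ Υ : Abar s n ⊗[K] A r n →ₗ[K] A r n ⊗[K] Abar s n,
      Diagram1 Υ ∧ Diagram2 Υ ∧
      (∀ f : A r n, Υ (1 ⊗ₜ f) = f ⊗ₜ 1) ∧
      (∀ g : Abar s n, Υ (g ⊗ₜ 1) = 1 ⊗ₜ g) ∧
      (tmulM (leg1 (L₁ := IPos r) (Tbar s n)) (leg2 (L₁ := I s) (Tplus r n))).map Υ =
        tmulM (rscal (leg2 (L₁ := I n) (Tplus r n)) (Sinv n)) (leg1 (L₁ := I n) (Tbar s n)) ∧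
      (∀ ε : ZMod 2, ∀ z ∈ gradeTensor (gradeAbar s n) (gradeA r n) ε,
        Υ z ∈ gradeTensor (gradeA r n) (gradeAbar s n) ε) ∧
      (∀ x y z : A r n ⊗[K] Abar s n,
        braidedMul Υ (braidedMul Υ (x ⊗ₜ y) ⊗ₜ z) = braidedMul Υ (x ⊗ₜ braidedMul Υ (y ⊗ₜ z))) ∧
      (∀ x : A r n ⊗[K] Abar s n,
        braidedMul Υ ((1 ⊗ₜ 1) ⊗ₜ x) = x ∧ braidedMul Υ (x ⊗ₜ (1 ⊗ₜ 1)) = x) := by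
  have hρ (j : I n × I s) (f : A r n) (c : Abar s n) := action_Tbar j f c
  have hl := twisting_mul_left (adjoin_Tbar s n) hρ
  have hr := twisting_mul_right (adjoin_Tbar s n) hρ
  have h1 := twisting_one_left (ρ := action r s n)
  have h2 := twisting_one_right (adjoin_Tbar s n) hρ
  exact ⟨braiding r s n, diagram1_of _ hr, diagram2_of _ hl, h1, h2, map_braiding_tmulM r s n,
    fun _ _ => braiding_mem, braidedMul_assoc _ hr hl,
    fun x => ⟨one_braidedMul _ h1 x, braidedMul_one _ h2 x⟩⟩
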